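/- We work over $\mathbb{C}$, and a form $P\,dx+Q\,dy$ of degree $d$ is written with $P,Q\in\mathbb{C}[x,y,z]$ homogeneous of degree $d$ ($z=1$ gives the affine form). A curve $F=0$, with $F\neq 0$ homogeneous, is an integral curve of $P\,dx+Q\,dy$ if $PF_y-QF_x=-FK$ for some homogeneous $K$ of degree $d-1$, the cofactor of $F$. The form is Darboux integrable with respect to integral curves $F_1,\dots,F_r$ with cofactors $K_1,\dots,K_r$ if $Q_x-P_y=\sum_i\alpha_iK_i$ for some $\alpha_i\in\mathbb{C}$. It is a Poincaré form if at the point $(0:0:1)$, evaluated at $(0,0,1)$, one has $P=Q=0$, $P_x=Q_y=1$, $P_y=Q_x=0$. Żołądek's family $CR_5$ consists of the forms of degree $3$ given in affine coordinates, with $T=x+y+c$, by $$\bigl(-kxy^2-ly+mx^2y-(nxy+p+qTx)(2x+y+c)\bigr)dx-x\bigl(l+p+mcx+(k+n)xy+mx^2+qTx\bigr)dy,$$ with $(c,k,l,m,n,p,q)\in\mathbb{C}^7$. Let $X_{CR5}$ be the set of all Poincaré forms of degree $3$ that arise from a member of this family by pullback under an invertible affine change of the coordinates $(x,y)$. Let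 $X_{(2,2)}$ be the set of Poincaré forms of degree $3$ that have two integral curves of degree $2$ in $\mathbb{P}^2$ which are smooth, are not tangent to the line at infinity $z=0$, are not tangent to each other, and do not meet each other on the line at infinity. **Proposition.** (i) There is a nonzero polynomial $\Delta$ in seven variables such that for all parameters with $\Delta(c,k,l,m,n,p,q)\neq0$ the following holds. There are exactly two points $(a_{20}:a_{11}:a_{00})\in\mathbb{P}^2$ for which the matrix $$\begin{pmatrix}a_{20}&q&-m-q\\-a_{11}&m-n-q&k+n+q\\a_{00}&p&-l-p\\0&-a_{20}&a_{11}\end{pmatrix}$$ has rank at most $2$. For each of them $(a_{20},a_{11})\neq(0,0)$, and the conic $a_{20}x^2+a_{11}xy+c\,a_{20}x+a_{00}=0$ (homogenized with $z$) is an integral curve of the form. The form is Darboux integrable with respect to these two conics. (ii) $X_{CR5}\subset\overline{X_{(2,2)}}$, where the bar denotes the Zariski closure in the space of forms of degree $3$. -/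

import Mathlib

open MvPolynomial

namespace CubicCenter

/-- The coordinate ring `ℂ[x, y, z]` of `ℙ²`, with `x = X 0`, `y = X 1`, `z = X 2`. -/
abbrev Poly : Type := MvPolynomial (Fin 3) ℂ

/-- A polynomial differential form `P dx + Q dy`, in homogeneous notation, is the pair `(P, Q)`. -/
abbrev Form : Type := Poly × Poly

/-- The space `V^d` of differential forms of degree `d`. -/
def formsOfDegree (d : ℕ) : Set Form :=
  {ω | ω.1.IsHomogeneous d ∧ ω.2.IsHomogeneous d}

/-- The set of Poincaré differential forms of degree `d`: the point `a = (0 : 0 : 1)` is critical,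
`P_x(a) = Q_y(a) = 1` and `P_y(a) = Q_x(a) = 0`. -/
def poincareForms (d : ℕ) : Set Form :=
  {ω | ω ∈ formsOfDegree d ∧
    eval ![0, 0, 1] ω.1 = 0 ∧ eval ![0, 0, 1] ω.2 = 0 ∧
    eval ![0, 0, 1] (pderiv 0 ω.1) = 1 ∧ eval ![0, 0, 1] (pderiv 1 ω.2) = 1 ∧
    eval ![0, 0, 1] (pderiv 1 ω.1) = 0 ∧ eval ![0, 0, 1] (pderiv 0 ω.2) = 0}

/-- The coordinates of a form: `coords ω (0, u)` and `coords ω (1, u)` are the coefficients of the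
monomial with exponent `u` in `P` and in `Q`. On `V^d` only those with `|u| = d` can be nonzero. -/
def coords (ω : Form) : Fin 2 × (Fin 3 →₀ ℕ) → ℂ :=
  fun i => coeff i.2 (![ω.1, ω.2] i.1)

/-- The Zariski closure of a set of forms: the common zeros of all polynomials in the coordinates
that vanish on the set. For a subset of `V^d` this is its closure in the affine space `V^d`, as the
coordinates of degree different from `d` are polynomials vanishing on the set. -/
def zariskiClosure (S : Set Form) : Set Form :=
  {ω | ∀ f : MvPolynomial (Fin 2 × (Fin 3 →₀ ℕ)) ℂ,
    (∀ η ∈ S, eval (coords η) f = 0) → eval (coords ω) f = 0}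

/-- `K` is a cofactor of `F` with respect to the form `P dx + Q dy` of degree `d`:
it is homogeneous of degree `d - 1` and `P F_y - Q F_x = - F K`. -/
def IsCofactor (d : ℕ) (ω : Form) (F K : Poly) : Prop :=
  K.IsHomogeneous (d - 1) ∧ ω.1 * pderiv 1 F - ω.2 * pderiv 0 F = -(F * K)

/-- The curve `F = 0` of degree `e` in `ℙ²` is an integral curve of the form `ω` of degree `d`. -/
def IsIntegralCurve (d : ℕ) (ω : Form) (e : ℕ) (F : Poly) : Prop :=
  F.IsHomogeneous e ∧ F ≠ 0 ∧ ∃ K : Poly, IsCofactor d ω F K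

/-- The form `P dx + Q dy` of degree `d` is Darboux integrable with respect to the curves `F i = 0`:
they are integral curves, and `Q_x - P_y` is a linear combination of their cofactors. -/
def IsDarbouxIntegrable (d : ℕ) (ω : Form) {r : ℕ} (F : Fin r → Poly) : Prop :=
  (∀ i, F i ≠ 0 ∧ ∃ e : ℕ, (F i).IsHomogeneous e) ∧
  ∃ (K : Fin r → Poly) (α : Fin r → ℂ), (∀ i, IsCofactor d ω (F i) (K i)) ∧
    pderiv 0 ω.2 - pderiv 1 ω.1 = ∑ i, C (α i) * K i

/-- The gradient of `F` at a point. -/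
noncomputable def grad (F : Poly) (v : Fin 3 → ℂ) : Fin 3 → ℂ :=
  fun j => eval v (pderiv j F)

/-- The curves `F i = 0` in `ℙ²` are smooth, none is tangent to the line at infinity `z = 0`, no two
are tangent to each other, no two meet the line at infinity in the same point, and no three meet in
the same point. Points of `ℙ²` are given by nonzero vectors. -/
structure GeneralPosition {r : ℕ} (F : Fin r → Poly) : Prop where
  smooth : ∀ i, ∀ v : Fin 3 → ℂ, v ≠ 0 → eval v (F i) = 0 → grad (F i) v ≠ 0
  not_tangent_infinity : ∀ i, ∀ v : Fin 3 → ℂ, v ≠ 0 → v 2 = 0 → eval v (F i) = 0 →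
    LinearIndependent ℂ ![grad (F i) v, ![0, 0, 1]]
  not_tangent : ∀ i j, i ≠ j → ∀ v : Fin 3 → ℂ, v ≠ 0 → eval v (F i) = 0 → eval v (F j) = 0 →
    LinearIndependent ℂ ![grad (F i) v, grad (F j) v]
  not_meet_infinity : ∀ i j, i ≠ j → ∀ v : Fin 3 → ℂ, v ≠ 0 → v 2 = 0 →
    ¬ (eval v (F i) = 0 ∧ eval v (F j) = 0)
  not_three_meet : ∀ i j k, i ≠ j → j ≠ k → i ≠ k → ∀ v : Fin 3 → ℂ, v ≠ 0 →
    ¬ (eval v (F i) = 0 ∧ eval v (F j) = 0 ∧ eval v (F k) = 0)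

/-- `Y_λ`, for `λ = (e 0, …, e (r-1))` a partition of `d + 1`: the forms of degree `d` that have
integral curves of degrees `e i` in general position. -/
def Y (d : ℕ) {r : ℕ} (e : Fin r → ℕ) : Set Form :=
  {ω | ω ∈ formsOfDegree d ∧ ∃ F : Fin r → Poly,
    (∀ i, IsIntegralCurve d ω (e i) (F i)) ∧ GeneralPosition F}

/-- `X_λ`: the Poincaré differential forms in `Y_λ`. -/
def X_ (d : ℕ) {r : ℕ} (e : Fin r → ℕ) : Set Form := Y d e ∩ poincareForms d

/-- The differential form of the family `CR_5` with parameters `c, k, l, m, n, p, q`, homogenized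
with `z`; here `T = x + y + c z`. -/
noncomputable def cr5Form (c k l m n p q : ℂ) : Form :=
  let x : Poly := X 0
  let y : Poly := X 1
  let z : Poly := X 2
  let T : Poly := x + y + C c * z
  (-C k * x * y ^ 2 - C l * y * z ^ 2 + C m * x ^ 2 * y
      - (C n * x * y + C p * z ^ 2 + C q * T * x) * (2 * x + y + C c * z),
    -x * (C l * z ^ 2 + C p * z ^ 2 + C m * C c * x * z + (C k + C n) * x * y + C m * x ^ 2
      + C q * T * x))

/-- The pullback of `P dx + Q dy` under the affine change of coordinates
`(x, y) ↦ (A 0 0 x + A 0 1 y + b 0, A 1 0 x + A 1 1 y + b 1)`, in homogeneous notation. -/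
noncomputable def affinePullback (A : Matrix (Fin 2) (Fin 2) ℂ) (b : Fin 2 → ℂ) (ω : Form) : Form :=
  let φ : Poly →ₐ[ℂ] Poly := aeval
    ![C (A 0 0) * X 0 + C (A 0 1) * X 1 + C (b 0) * X 2,
      C (A 1 0) * X 0 + C (A 1 1) * X 1 + C (b 1) * X 2,
      X 2]
  (C (A 0 0) * φ ω.1 + C (A 1 0) * φ ω.2, C (A 0 1) * φ ω.1 + C (A 1 1) * φ ω.2)

/-- `Y_{CR5}`: all forms obtained from the members of the family by an affine change of coordinates.
(Scalar multiples are included, as the family is linear in `k, l, m, n, p, q`.) -/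
def YCR5 : Set Form :=
  {ω | ∃ (c k l m n p q : ℂ) (A : Matrix (Fin 2) (Fin 2) ℂ) (b : Fin 2 → ℂ),
    IsUnit A.det ∧ ω = affinePullback A b (cr5Form c k l m n p q)}

/-- `X_{CR5}`: the Poincaré differential forms in `Y_{CR5}`. -/
def XCR5 : Set Form := YCR5 ∩ poincareForms 3

/-- The conic `a₂₀ x² + a₁₁ x y + c a₂₀ x z + a₀₀ z²` where `(a₂₀, a₁₁, a₀₀) = (a 0, a 1, a 2)`. -/
noncomputable def conic (c : ℂ) (a : Fin 3 → ℂ) : Poly :=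
  C (a 0) * X 0 ^ 2 + C (a 1) * X 0 * X 1 + C (c * a 0) * X 0 * X 2 + C (a 2) * X 2 ^ 2

/-- The `4 × 3` matrix that determines the conics, where `(a₂₀, a₁₁, a₀₀) = (a 0, a 1, a 2)`. -/
def conicMatrix (k l m n p q : ℂ) (a : Fin 3 → ℂ) : Matrix (Fin 4) (Fin 3) ℂ :=
  !![a 0, q, -m - q;
     -a 1, m - n - q, k + n + q;
     a 2, p, -l - p;
     0, -a 0, a 1]

end CubicCenter

/-!
The key to both parts is the map `(u, v) = (x² + c x, x y)`. A member of the family `CR₅` is the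
pullback under it of an arbitrary form `α du + β dv` with affine-linear `α` and `β`
(`affinePullback_one_cr5Form`), and the conics of the proposition are the pullbacks of the invariant
lines of that form.

Part (i). The invariant lines correspond to the eigenvectors of the linear part of `α du + β dv`. If
the two eigenvalues are distinct and nonzero there are exactly two lines, and the rank condition is
the eigenvector equation. The cofactor of a conic is minus the eigenvalue times the Jacobian
determinant `x (2 x + c)`, so that the trace of the linear part gives Darboux integrability with both
multipliers equal to `1` (`exists_two_conics`).

Part (ii). The two conics of a member of `CR₅` meet at infinity, in `(0 : 1 : 0)`, so a perturbation
is needed. The Zariski closure is closed under limits of coefficients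
(`mem_zariskiClosure_of_tendsto`), and a linear change of coordinates that tends to the identity
restores the normalization of the linear part, as long as the critical point is kept and its linear
part stays symmetric (`IsGood.of_tendsto`). A form `r G dF + s F dG` with conics `F` and `G` stays of
this kind if only the quadratic parts of `F` and `G` at the critical point are changed, which
suffices to reach general position (`isGood_logForm_of_isGeneric`); the latter is expressed by the
nonvanishing of a few polynomials in the coefficients (`IsGeneric.generalPosition`).

It remains to write the members of `CR₅` as limits of such forms. At a critical point with symmetric
linear part the closedness of the linear part reads `x (2 x + c) (β_u - α_v) = 0`. If the point is
ramified, `x (2 x + c) = 0`, then the linear part of `α du + β dv` can be perturbed freely, and for a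
generic choice the form has two invariant lines that avoid the image of the point
(`isGood_uvForm_of_ramified`). Otherwise the form is exact, its Hamiltonian is a quadratic polynomial
in `u` and `v` with a nondegenerate critical point, and the Hamiltonian minus its critical value
splits into two linear factors (`isGood_uvForm_of_exact`).
-/

namespace CubicCenter

open Filter Topology

/-! ### Affine substitutions -/

/-- The substitution of coordinates that underlies `affinePullback`. -/
noncomputable def affineSubst (A : Matrix (Fin 2) (Fin 2) ℂ) (b : Fin 2 → ℂ) : Poly →ₐ[ℂ] Poly :=
  aeval
    ![C (A 0 0) * X 0 + C (A 0 1) * X 1 + C (b 0) * X 2,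
      C (A 1 0) * X 0 + C (A 1 1) * X 1 + C (b 1) * X 2,
      X 2]

theorem affinePullback_eq (A : Matrix (Fin 2) (Fin 2) ℂ) (b : Fin 2 → ℂ) (ω : Form) :
    affinePullback A b ω =
      (C (A 0 0) * affineSubst A b ω.1 + C (A 1 0) * affineSubst A b ω.2,
        C (A 0 1) * affineSubst A b ω.1 + C (A 1 1) * affineSubst A b ω.2) := rfl

theorem affineSubst_C (A : Matrix (Fin 2) (Fin 2) ℂ) (b : Fin 2 → ℂ) (r : ℂ) :
    affineSubst A b (C r) = C r := by
  simp [affineSubst, MvPolynomial.algebraMap_eq]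

theorem affineSubst_X (A : Matrix (Fin 2) (Fin 2) ℂ) (b : Fin 2 → ℂ) (i : Fin 3) :
    affineSubst A b (X i) =
      ![C (A 0 0) * X 0 + C (A 0 1) * X 1 + C (b 0) * X 2,
        C (A 1 0) * X 0 + C (A 1 1) * X 1 + C (b 1) * X 2,
        X 2] i := by
  simp [affineSubst]

theorem affineSubst_comp (A B : Matrix (Fin 2) (Fin 2) ℂ) (b : Fin 2 → ℂ) (p : Poly) :
    affineSubst B 0 (affineSubst A b p) = affineSubst (A * B) b p := by
  rw [← AlgHom.comp_apply]
  congr 1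
  apply MvPolynomial.algHom_ext
  intro i
  fin_cases i <;>
    simp [affineSubst_X, Matrix.mul_apply, Fin.sum_univ_two] <;> ring

theorem affinePullback_comp (A B : Matrix (Fin 2) (Fin 2) ℂ) (b : Fin 2 → ℂ) (ω : Form) :
    affinePullback B 0 (affinePullback A b ω) = affinePullback (A * B) b ω := by
  simp only [affinePullback_eq, map_add, map_mul, affineSubst_C, affineSubst_comp,
    Matrix.mul_apply, Fin.sum_univ_two]
  ext1 <;> ring

/-- The chain rule for substitution into a polynomial. -/
theorem pderiv_aeval (g : Fin 3 → Poly) (i : Fin 3) (p : Poly) :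
    pderiv i (aeval g p) = ∑ j, aeval g (pderiv j p) * pderiv i (g j) := by
  induction p using MvPolynomial.induction_on with
  | C a => simp [MvPolynomial.algebraMap_eq]
  | add p q hp hq => simp only [map_add, hp, hq, add_mul, Finset.sum_add_distrib]
  | mul_X p n hp =>
    have h : ∑ j, aeval g (pderiv j (X n : Poly)) * pderiv i (g j) = pderiv i (g n) := by
      rw [Finset.sum_eq_single n]
      · rw [pderiv_X_self, map_one, one_mul]
      · intro j _ hj
        rw [pderiv_X_of_ne hj.symm, map_zero, zero_mul]
      · simp
    rw [map_mul, aeval_X, pderiv_mul, hp, ← h, Finset.sum_mul, Finset.mul_sum,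
      ← Finset.sum_add_distrib]
    refine Finset.sum_congr rfl fun j _ => ?_
    rw [pderiv_mul, map_add, map_mul, map_mul, aeval_X]
    ring

theorem pderiv_zero_affineSubst (A : Matrix (Fin 2) (Fin 2) ℂ) (b : Fin 2 → ℂ) (p : Poly) :
    pderiv 0 (affineSubst A b p) =
      C (A 0 0) * affineSubst A b (pderiv 0 p) + C (A 1 0) * affineSubst A b (pderiv 1 p) := by
  rw [affineSubst, pderiv_aeval]
  simp [Fin.sum_univ_three, pderiv_X]
  ring

theorem pderiv_one_affineSubst (A : Matrix (Fin 2) (Fin 2) ℂ) (b : Fin 2 → ℂ) (p : Poly) :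
    pderiv 1 (affineSubst A b p) =
      C (A 0 1) * affineSubst A b (pderiv 0 p) + C (A 1 1) * affineSubst A b (pderiv 1 p) := by
  rw [affineSubst, pderiv_aeval]
  simp [Fin.sum_univ_three, pderiv_X]
  ring

theorem pderiv_two_affineSubst (A : Matrix (Fin 2) (Fin 2) ℂ) (p : Poly) :
    pderiv 2 (affineSubst A 0 p) = affineSubst A 0 (pderiv 2 p) := by
  rw [affineSubst, pderiv_aeval]
  simp [Fin.sum_univ_three, pderiv_X]

/-- The linear map of `ℂ³` that extends `A` by the identity on the last coordinate. -/
def liftVec (A : Matrix (Fin 2) (Fin 2) ℂ) (v : Fin 3 → ℂ) : Fin 3 → ℂ :=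
  ![A 0 0 * v 0 + A 0 1 * v 1, A 1 0 * v 0 + A 1 1 * v 1, v 2]

theorem eval_affineSubst (A : Matrix (Fin 2) (Fin 2) ℂ) (v : Fin 3 → ℂ) (p : Poly) :
    eval v (affineSubst A 0 p) = eval (liftVec A v) p := by
  induction p using MvPolynomial.induction_on with
  | C a => simp
  | add p q hp hq => simp [hp, hq]
  | mul_X p n hp =>
    rw [map_mul, map_mul, hp, map_mul, affineSubst_X]
    fin_cases n <;> simp [liftVec]

theorem liftVec_base (A : Matrix (Fin 2) (Fin 2) ℂ) : liftVec A ![0, 0, 1] = ![0, 0, 1] := by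
  ext i; fin_cases i <;> simp [liftVec]

theorem affineSubst_isHomogeneous (A : Matrix (Fin 2) (Fin 2) ℂ) (b : Fin 2 → ℂ) {p : Poly} {d : ℕ}
    (hp : p.IsHomogeneous d) : (affineSubst A b p).IsHomogeneous d := by
  have := hp.aeval (n := 1)
    ![C (A 0 0) * X 0 + C (A 0 1) * X 1 + C (b 0) * X 2,
      C (A 1 0) * X 0 + C (A 1 1) * X 1 + C (b 1) * X 2, (X 2 : Poly)] (by
    have h : ∀ (r : ℂ) (i : Fin 3), (C r * X i : Poly).IsHomogeneous 1 := fun r i => by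
      simpa using (isHomogeneous_C (Fin 3) r).mul (isHomogeneous_X ℂ i)
    intro i
    fin_cases i
    · exact ((h _ _).add (h _ _)).add (h _ _)
    · exact ((h _ _).add (h _ _)).add (h _ _)
    · exact isHomogeneous_X ℂ 2)
  rwa [one_mul] at this

theorem isHomogeneous_C_mul_affineSubst (A : Matrix (Fin 2) (Fin 2) ℂ) (b : Fin 2 → ℂ) (r : ℂ)
    {p : Poly} {d : ℕ} (hp : p.IsHomogeneous d) :
    (C r * affineSubst A b p).IsHomogeneous d := by
  simpa using (isHomogeneous_C (Fin 3) r).mul (affineSubst_isHomogeneous A b hp)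

theorem affinePullback_mem_formsOfDegree (A : Matrix (Fin 2) (Fin 2) ℂ) (b : Fin 2 → ℂ) {ω : Form}
    {d : ℕ} (hω : ω ∈ formsOfDegree d) : affinePullback A b ω ∈ formsOfDegree d := by
  rw [affinePullback_eq]
  exact ⟨(isHomogeneous_C_mul_affineSubst A b _ hω.1).add
      (isHomogeneous_C_mul_affineSubst A b _ hω.2),
    (isHomogeneous_C_mul_affineSubst A b _ hω.1).add
      (isHomogeneous_C_mul_affineSubst A b _ hω.2)⟩

theorem liftVec_ne_zero {A : Matrix (Fin 2) (Fin 2) ℂ} (hA : A.det ≠ 0) {v : Fin 3 → ℂ}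
    (hv : v ≠ 0) : liftVec A v ≠ 0 := by
  intro h
  apply hv
  have h0 := congrFun h 0
  have h1 := congrFun h 1
  have h2 := congrFun h 2
  simp [liftVec] at h0 h1 h2
  rw [Matrix.det_fin_two] at hA
  have e0 : v 0 = 0 := by
    apply (mul_eq_zero.1 _).resolve_left hA
    linear_combination A 1 1 * h0 - A 0 1 * h1
  have e1 : v 1 = 0 := by
    apply (mul_eq_zero.1 _).resolve_left hA
    linear_combination A 0 0 * h1 - A 1 0 * h0
  ext i; fin_cases i <;> simp [e0, e1, h2]

/-- The transpose of `liftVec A`. -/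
def liftCovec (A : Matrix (Fin 2) (Fin 2) ℂ) (w : Fin 3 → ℂ) : Fin 3 → ℂ :=
  ![A 0 0 * w 0 + A 1 0 * w 1, A 0 1 * w 0 + A 1 1 * w 1, w 2]

theorem grad_affineSubst (A : Matrix (Fin 2) (Fin 2) ℂ) (F : Poly) (v : Fin 3 → ℂ) :
    grad (affineSubst A 0 F) v = liftCovec A (grad F (liftVec A v)) := by
  ext i
  fin_cases i <;>
    simp [grad, liftCovec, pderiv_zero_affineSubst, pderiv_one_affineSubst,
      pderiv_two_affineSubst, eval_affineSubst]

theorem liftCovec_ne_zero {A : Matrix (Fin 2) (Fin 2) ℂ} (hA : A.det ≠ 0) {w : Fin 3 → ℂ}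
    (hw : w ≠ 0) : liftCovec A w ≠ 0 := by
  have h := liftVec_ne_zero (A := A.transpose) (by rwa [Matrix.det_transpose]) hw
  simpa [liftVec, liftCovec] using h

theorem liftCovec_linearIndependent {A : Matrix (Fin 2) (Fin 2) ℂ} (hA : A.det ≠ 0)
    {w w' : Fin 3 → ℂ} (h : LinearIndependent ℂ ![w, w']) :
    LinearIndependent ℂ ![liftCovec A w, liftCovec A w'] := by
  rw [LinearIndependent.pair_iff] at h ⊢
  intro s t hst
  apply h
  by_contra hne
  apply liftCovec_ne_zero hA hne
  rw [← hst]
  ext i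
  fin_cases i <;> simp [liftCovec] <;> ring

theorem generalPosition_affineSubst {r : ℕ} {F : Fin r → Poly} (hF : GeneralPosition F)
    {A : Matrix (Fin 2) (Fin 2) ℂ} (hA : A.det ≠ 0) :
    GeneralPosition fun i => affineSubst A 0 (F i) where
  smooth i v hv h0 := by
    rw [eval_affineSubst] at h0
    rw [grad_affineSubst]
    exact liftCovec_ne_zero hA (hF.smooth i _ (liftVec_ne_zero hA hv) h0)
  not_tangent_infinity i v hv h2 h0 := by
    rw [eval_affineSubst] at h0
    rw [grad_affineSubst]
    have := liftCovec_linearIndependent hA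
      (hF.not_tangent_infinity i _ (liftVec_ne_zero hA hv) (by simpa [liftVec] using h2) h0)
    simpa [liftCovec] using this
  not_tangent i j hij v hv hi hj := by
    rw [eval_affineSubst] at hi hj
    rw [grad_affineSubst, grad_affineSubst]
    exact liftCovec_linearIndependent hA
      (hF.not_tangent i j hij _ (liftVec_ne_zero hA hv) hi hj)
  not_meet_infinity i j hij v hv h2 h := by
    simp only [eval_affineSubst] at h
    exact hF.not_meet_infinity i j hij _ (liftVec_ne_zero hA hv) (by simpa [liftVec] using h2) h
  not_three_meet i j k hij hjk hik v hv h := by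
    simp only [eval_affineSubst] at h
    exact hF.not_three_meet i j k hij hjk hik _ (liftVec_ne_zero hA hv) h

theorem isIntegralCurve_affineSubst {d e : ℕ} {ω : Form} {F : Poly}
    (hF : IsIntegralCurve d ω e F) {A : Matrix (Fin 2) (Fin 2) ℂ} (hA : A.det ≠ 0) :
    IsIntegralCurve d (affinePullback A 0 ω) e (affineSubst A 0 F) := by
  obtain ⟨hh, h0, K, hK, hK'⟩ := hF
  refine ⟨affineSubst_isHomogeneous A 0 hh, ?_, C A.det * affineSubst A 0 K,
    isHomogeneous_C_mul_affineSubst A 0 _ hK, ?_⟩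
  · -- the inverse matrix recovers `F`
    intro h
    apply h0
    have h1 : affineSubst A⁻¹ 0 (affineSubst A 0 F) = F := by
      rw [affineSubst_comp, Matrix.mul_nonsing_inv _ hA.isUnit]
      have h2 : affineSubst 1 0 = AlgHom.id ℂ Poly := by
        apply MvPolynomial.algHom_ext
        intro i
        fin_cases i <;> simp [affineSubst_X]
      rw [h2]
      rfl
    rw [← h1, h, map_zero]
  · have h1 := congrArg (affineSubst A 0) hK'
    simp only [map_sub, map_mul, map_neg] at h1
    simp only [affinePullback_eq, pderiv_zero_affineSubst, pderiv_one_affineSubst,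
      Matrix.det_fin_two, C_sub, C_mul]
    linear_combination (C (A 0 0) * C (A 1 1) - C (A 0 1) * C (A 1 0)) * h1

theorem affinePullback_mem_Y {d r : ℕ} {e : Fin r → ℕ} {ω : Form} (hω : ω ∈ Y d e)
    {A : Matrix (Fin 2) (Fin 2) ℂ} (hA : A.det ≠ 0) : affinePullback A 0 ω ∈ Y d e := by
  obtain ⟨hd, F, hF, hG⟩ := hω
  exact ⟨affinePullback_mem_formsOfDegree A 0 hd, fun i => affineSubst A 0 (F i),
    fun i => isIntegralCurve_affineSubst (hF i) hA, generalPosition_affineSubst hG hA⟩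

/-! ### Limits of forms -/

/-- Coefficientwise convergence `p s → q` as `s → 0`, `s ≠ 0`. -/
def CoeffTendsto (p : ℂ → Poly) (q : Poly) : Prop :=
  ∀ u, Tendsto (fun s => coeff u (p s)) (𝓝[≠] 0) (𝓝 (coeff u q))

theorem CoeffTendsto.const (p : Poly) : CoeffTendsto (fun _ => p) p :=
  fun _ => tendsto_const_nhds

theorem CoeffTendsto.add {p p' : ℂ → Poly} {q q' : Poly} (h : CoeffTendsto p q)
    (h' : CoeffTendsto p' q') : CoeffTendsto (fun s => p s + p' s) (q + q') := fun u => by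
  simpa only [coeff_add] using (h u).add (h' u)

theorem CoeffTendsto.mul {p p' : ℂ → Poly} {q q' : Poly} (h : CoeffTendsto p q)
    (h' : CoeffTendsto p' q') : CoeffTendsto (fun s => p s * p' s) (q * q') := fun u => by
  simp only [coeff_mul]
  exact tendsto_finsetSum _ fun x _ => (h x.1).mul (h' x.2)

theorem CoeffTendsto.pow {p : ℂ → Poly} {q : Poly} (h : CoeffTendsto p q) (n : ℕ) :
    CoeffTendsto (fun s => p s ^ n) (q ^ n) := by
  induction n with
  | zero => simpa using CoeffTendsto.const 1
  | succ n ih => simpa only [pow_succ] using ih.mul h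

theorem CoeffTendsto.C {f : ℂ → ℂ} {a : ℂ} (h : Tendsto f (𝓝[≠] 0) (𝓝 a)) :
    CoeffTendsto (fun s => MvPolynomial.C (f s)) (MvPolynomial.C a) := fun u => by
  classical
  simp only [coeff_C]
  split_ifs
  · exact h
  · exact tendsto_const_nhds

theorem CoeffTendsto.sum {ι : Type*} (S : Finset ι) {p : ι → ℂ → Poly} {q : ι → Poly}
    (h : ∀ i ∈ S, CoeffTendsto (p i) (q i)) :
    CoeffTendsto (fun s => ∑ i ∈ S, p i s) (∑ i ∈ S, q i) := fun u => by
  simp only [coeff_sum]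
  exact tendsto_finsetSum _ fun i hi => h i hi u

theorem CoeffTendsto.finsetProd {ι : Type*} (S : Finset ι) {p : ι → ℂ → Poly} {q : ι → Poly}
    (h : ∀ i, CoeffTendsto (p i) (q i)) :
    CoeffTendsto (fun s => ∏ i ∈ S, p i s) (∏ i ∈ S, q i) := by
  classical
  induction S using Finset.induction_on with
  | empty => simpa using CoeffTendsto.const 1
  | insert i S hi ih => simpa only [Finset.prod_insert hi] using (h i).mul ih

theorem sum_monomial_of_isHomogeneous {p : Poly} {d : ℕ} (hp : p.IsHomogeneous d) :
    p = ∑ u ∈ Finset.finsuppAntidiag Finset.univ d, monomial u (coeff u p) := by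
  conv_lhs => rw [← support_sum_monomial_coeff p]
  apply Finset.sum_subset
  · intro u hu
    rw [Finset.mem_finsuppAntidiag]
    refine ⟨?_, Finset.subset_univ _⟩
    by_contra h
    rw [mem_support_iff] at hu
    apply hu
    apply hp.coeff_eq_zero
    rwa [Finsupp.degree_eq_sum]
  · intro u _ hu
    rw [notMem_support_iff.1 hu, monomial_zero]

/-- Homogeneity of a fixed degree keeps the forms in a finite-dimensional space, where
coefficientwise convergence is respected by every linear functional. -/
theorem CoeffTendsto.map_linear {p : ℂ → Poly} {q : Poly} {d : ℕ} (h : CoeffTendsto p q)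
    (hp : ∀ s, (p s).IsHomogeneous d) (hq : q.IsHomogeneous d) (T : Poly →ₗ[ℂ] ℂ) :
    Tendsto (fun s => T (p s)) (𝓝[≠] 0) (𝓝 (T q)) := by
  have key : ∀ r : Poly, r.IsHomogeneous d →
      T r = ∑ u ∈ Finset.finsuppAntidiag Finset.univ d, coeff u r * T (monomial u 1) := by
    intro r hr
    conv_lhs => rw [sum_monomial_of_isHomogeneous hr]
    rw [map_sum]
    refine Finset.sum_congr rfl fun u _ => ?_
    rw [← mul_one (coeff u r), ← smul_eq_mul (coeff u r), ← smul_monomial, map_smul,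
      smul_eq_mul, smul_eq_mul, mul_one]
  rw [key q hq]
  simp only [fun s => key (p s) (hp s)]
  exact tendsto_finsetSum _ fun u _ => (h u).mul tendsto_const_nhds

theorem CoeffTendsto.affineSubst {p : ℂ → Poly} {q : Poly} {d : ℕ} (h : CoeffTendsto p q)
    (hp : ∀ s, (p s).IsHomogeneous d) (hq : q.IsHomogeneous d)
    {A : ℂ → Matrix (Fin 2) (Fin 2) ℂ} {A' : Matrix (Fin 2) (Fin 2) ℂ}
    (hA : ∀ i j, Tendsto (fun s => A s i j) (𝓝[≠] 0) (𝓝 (A' i j))) :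
    CoeffTendsto (fun s => CubicCenter.affineSubst (A s) 0 (p s))
      (CubicCenter.affineSubst A' 0 q) := by
  have key : ∀ (B : Matrix (Fin 2) (Fin 2) ℂ) (r : Poly), r.IsHomogeneous d →
      CubicCenter.affineSubst B 0 r = ∑ u ∈ Finset.finsuppAntidiag Finset.univ d,
        MvPolynomial.C (coeff u r) * ∏ i, (CubicCenter.affineSubst B 0 (X i)) ^ u i := by
    intro B r hr
    conv_lhs => rw [sum_monomial_of_isHomogeneous hr]
    rw [map_sum]
    refine Finset.sum_congr rfl fun u _ => ?_
    rw [monomial_eq, map_mul, affineSubst_C, Finsupp.prod_fintype _ _ (by simp), map_prod]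
    simp only [map_pow]
  rw [key A' q hq]
  simp only [fun s => key (A s) (p s) (hp s)]
  refine CoeffTendsto.sum _ fun u _ => (CoeffTendsto.C (h u)).mul ?_
  refine CoeffTendsto.finsetProd _ fun i => CoeffTendsto.pow ?_ _
  simp only [affineSubst_X]
  fin_cases i
  · exact (((CoeffTendsto.C (hA 0 0)).mul (.const _)).add
      ((CoeffTendsto.C (hA 0 1)).mul (.const _))).add (.const _)
  · exact (((CoeffTendsto.C (hA 1 0)).mul (.const _)).add
      ((CoeffTendsto.C (hA 1 1)).mul (.const _))).add (.const _)
  · exact .const _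

/-- A polynomial function of the coordinates is continuous, so the Zariski closure is closed under
coefficientwise limits. -/
theorem mem_zariskiClosure_of_tendsto {S : Set Form} {η : ℂ → Form} {η₀ : Form}
    (h1 : CoeffTendsto (fun s => (η s).1) η₀.1) (h2 : CoeffTendsto (fun s => (η s).2) η₀.2)
    (h : ∀ᶠ s in 𝓝[≠] 0, η s ∈ zariskiClosure S) : η₀ ∈ zariskiClosure S := by
  intro f hf
  have ht : Tendsto (fun s => coords (η s)) (𝓝[≠] 0) (𝓝 (coords η₀)) := by
    rw [tendsto_pi_nhds]
    rintro ⟨i, u⟩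
    fin_cases i
    · exact h1 u
    · exact h2 u
  have ht' := ((continuous_eval f).tendsto (coords η₀)).comp ht
  refine tendsto_nhds_unique ht' (Tendsto.congr' ?_ tendsto_const_nhds)
  filter_upwards [h] with s hs
  exact (hs f hf).symm

theorem subset_zariskiClosure (S : Set Form) : S ⊆ zariskiClosure S := fun _ hη _ hf => hf _ hη

/-! ### Normalization of the linear part -/

/-- The point `(0 : 0 : 1)`, which a Poincaré form has as a critical point. -/
abbrev base : Fin 3 → ℂ := ![0, 0, 1]

/-- The value of `P` or `Q` at the base point. -/
noncomputable abbrev val (p : Poly) : ℂ := eval base p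

theorem val_affineSubst (A : Matrix (Fin 2) (Fin 2) ℂ) (p : Poly) :
    val (affineSubst A 0 p) = val p := by
  rw [val, eval_affineSubst, liftVec_base]

/-- A form all of whose linear pullbacks that are Poincaré forms lie in the closure of
`X_(2,2)`. -/
def IsGood (η : Form) : Prop :=
  ∀ A : Matrix (Fin 2) (Fin 2) ℂ, A.det ≠ 0 → affinePullback A 0 η ∈ poincareForms 3 →
    affinePullback A 0 η ∈ zariskiClosure (X_ 3 ![2, 2])

theorem isGood_of_mem_Y {η : Form} (h : η ∈ Y 3 ![2, 2]) : IsGood η := fun _ hA hP =>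
  subset_zariskiClosure _ ⟨affinePullback_mem_Y h hA, hP⟩

/-- A square root on `ℂ` that is continuous near `1`. -/
noncomputable def sqrtNearOne (w : ℂ) : ℂ := Complex.exp (Complex.log w / 2)

theorem sqrtNearOne_sq {w : ℂ} (hw : w ≠ 0) : sqrtNearOne w ^ 2 = w := by
  rw [sqrtNearOne, ← Complex.exp_nat_mul]
  push_cast
  rw [mul_div_cancel₀ _ (two_ne_zero), Complex.exp_log hw]

theorem sqrtNearOne_ne_zero (w : ℂ) : sqrtNearOne w ≠ 0 := Complex.exp_ne_zero _

theorem tendsto_sqrtNearOne : Tendsto sqrtNearOne (𝓝 1) (𝓝 1) := by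
  have h : ContinuousAt sqrtNearOne 1 := by
    unfold sqrtNearOne
    have : ContinuousAt Complex.log 1 := continuousAt_clog (by simp)
    fun_prop
  simpa [ContinuousAt, sqrtNearOne] using h

/-- Gram–Schmidt for symmetric bilinear forms with Gram matrix `[[a, b], [b, e]]` close to the
identity. -/
theorem exists_orthonormal_basis {a b e : ℂ → ℂ} (ha : Tendsto a (𝓝[≠] 0) (𝓝 1))
    (hb : Tendsto b (𝓝[≠] 0) (𝓝 0)) (he : Tendsto e (𝓝[≠] 0) (𝓝 1)) :
    ∃ B : ℂ → Matrix (Fin 2) (Fin 2) ℂ,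
      (∀ i j, Tendsto (fun s => B s i j) (𝓝[≠] 0) (𝓝 ((1 : Matrix (Fin 2) (Fin 2) ℂ) i j))) ∧
      ∀ᶠ s in 𝓝[≠] 0, (B s).det ≠ 0 ∧ B s 1 0 = 0 ∧ B s 0 0 ^ 2 * a s = 1 ∧
        a s * B s 0 1 + b s * B s 1 1 = 0 ∧
        a s * B s 0 1 ^ 2 + 2 * b s * B s 0 1 * B s 1 1 + e s * B s 1 1 ^ 2 = 1 := by
  have hw : Tendsto (fun s => e s - b s ^ 2 / a s) (𝓝[≠] 0) (𝓝 1) := by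
    simpa using he.sub ((hb.pow 2).div ha one_ne_zero)
  have hra := tendsto_sqrtNearOne.comp ha
  have hrw := tendsto_sqrtNearOne.comp hw
  refine ⟨fun s => !![(sqrtNearOne (a s))⁻¹, -(b s / a s * (sqrtNearOne (e s - b s ^ 2 / a s))⁻¹);
    0, (sqrtNearOne (e s - b s ^ 2 / a s))⁻¹], ?_, ?_⟩
  · intro i j
    fin_cases i <;> fin_cases j
    · simpa using hra.inv₀ one_ne_zero
    · simpa using ((hb.div ha one_ne_zero).mul (hrw.inv₀ one_ne_zero)).neg
    · simp
    · simpa using hrw.inv₀ one_ne_zero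
  · filter_upwards [ha.eventually_ne one_ne_zero, hw.eventually_ne one_ne_zero] with s h1 h2
    have e1 := sqrtNearOne_sq h1
    have e2 := sqrtNearOne_sq h2
    have n1 := sqrtNearOne_ne_zero (a s)
    have n2 := sqrtNearOne_ne_zero (e s - b s ^ 2 / a s)
    generalize sqrtNearOne (a s) = r at *
    generalize sqrtNearOne (e s - b s ^ 2 / a s) = t at *
    refine ⟨by simp [Matrix.det_fin_two, n1, n2], by simp, ?_, ?_, ?_⟩
    · simp [e1, h1]
    · simp
      field_simp
      ring
    · simp
      field_simp
      field_simp at e2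
      linear_combination -e2

/-- Goodness passes to limits, as long as the base point stays critical with symmetric linear part:
the linear parts of the pullbacks tend to the identity and can be normalized by matrices that tend
to the identity. -/
theorem IsGood.of_tendsto {η : ℂ → Form} {η₀ : Form} (hd : ∀ s, η s ∈ formsOfDegree 3)
    (hd₀ : η₀ ∈ formsOfDegree 3)
    (h1 : CoeffTendsto (fun s => (η s).1) η₀.1) (h2 : CoeffTendsto (fun s => (η s).2) η₀.2)
    (hP : ∀ s, val (η s).1 = 0) (hQ : ∀ s, val (η s).2 = 0)
    (hJ : ∀ s, val (pderiv 1 (η s).1) = val (pderiv 0 (η s).2))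
    (hg : ∀ᶠ s in 𝓝[≠] 0, IsGood (η s)) : IsGood η₀ := by
  intro A hA hAP
  set ω : ℂ → Form := fun s => affinePullback A 0 (η s) with hω
  have hωd : ∀ s, ω s ∈ formsOfDegree 3 := fun s => affinePullback_mem_formsOfDegree A 0 (hd s)
  have hωd₀ := affinePullback_mem_formsOfDegree A 0 hd₀
  have t1 := h1.affineSubst (fun s => (hd s).1) hd₀.1 (A := fun _ => A)
    (fun _ _ => tendsto_const_nhds)
  have t2 := h2.affineSubst (fun s => (hd s).2) hd₀.2 (A := fun _ => A)
    (fun _ _ => tendsto_const_nhds)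
  have w1 : CoeffTendsto (fun s => (ω s).1) (affinePullback A 0 η₀).1 :=
    ((CoeffTendsto.const _).mul t1).add ((CoeffTendsto.const _).mul t2)
  have w2 : CoeffTendsto (fun s => (ω s).2) (affinePullback A 0 η₀).2 :=
    ((CoeffTendsto.const _).mul t1).add ((CoeffTendsto.const _).mul t2)
  have lim : ∀ (i : Fin 3) {p : ℂ → Poly} {q : Poly}, CoeffTendsto p q →
      (∀ s, (p s).IsHomogeneous 3) → q.IsHomogeneous 3 →
      Tendsto (fun s => val (pderiv i (p s))) (𝓝[≠] 0) (𝓝 (val (pderiv i q))) :=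
    fun i p q h hp hq => h.map_linear hp hq
      ((aeval (R := ℂ) base).toLinearMap.comp (pderiv i).toLinearMap)
  obtain ⟨-, -, -, pxx, pyy, pxy, pyx⟩ := hAP
  have j1 := lim 0 w1 (fun s => (hωd s).1) hωd₀.1
  have j2 := lim 1 w1 (fun s => (hωd s).1) hωd₀.1
  have j3 := lim 1 w2 (fun s => (hωd s).2) hωd₀.2
  rw [val, pxx] at j1
  rw [val, pxy] at j2
  rw [val, pyy] at j3
  obtain ⟨B, hB, hB'⟩ := exists_orthonormal_basis j1 j2 j3
  have hsym : ∀ s, val (pderiv 0 (ω s).2) = val (pderiv 1 (ω s).1) := by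
    intro s
    have := hJ s
    simp only [hω, affinePullback_eq, map_add, pderiv_C_mul, pderiv_zero_affineSubst,
      pderiv_one_affineSubst, map_mul, eval_C, val_affineSubst] at this ⊢
    linear_combination (A 0 0 * A 1 1 - A 0 1 * A 1 0) * (-this)
  have hω0 : ∀ s, val (ω s).1 = 0 ∧ val (ω s).2 = 0 := by
    intro s
    simp only [hω, affinePullback_eq, map_add, map_mul, eval_C, val_affineSubst, hP s, hQ s]
    simp
  have one_pull : affinePullback 1 0 (affinePullback A 0 η₀) = affinePullback A 0 η₀ := by
    rw [affinePullback_comp, mul_one]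
  rw [← one_pull]
  have c1 := w1.affineSubst (fun s => (hωd s).1) hωd₀.1 hB
  have c2 := w2.affineSubst (fun s => (hωd s).2) hωd₀.2 hB
  refine mem_zariskiClosure_of_tendsto (η := fun s => affinePullback (B s) 0 (ω s))
    (((CoeffTendsto.C (hB 0 0)).mul c1).add ((CoeffTendsto.C (hB 1 0)).mul c2))
    (((CoeffTendsto.C (hB 0 1)).mul c1).add ((CoeffTendsto.C (hB 1 1)).mul c2)) ?_
  filter_upwards [hB', hg] with s ⟨b0, b1, b2, b3, b4⟩ hs
  have hdet : (A * B s).det ≠ 0 := by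
    rw [Matrix.det_mul]
    exact mul_ne_zero hA b0
  have := hs (A * B s) hdet
  rw [← affinePullback_comp] at this
  apply this
  refine ⟨affinePullback_mem_formsOfDegree _ 0 (hωd s), ?_⟩
  have e1 := hsym s
  obtain ⟨e2, e3⟩ := hω0 s
  change _ ∧ _
  simp only [hω] at e1 e2 e3 b2 b3 b4
  generalize affinePullback A 0 (η s) = θ at *
  change val _ = 0 ∧ val _ = 0 ∧ val _ = 1 ∧ val _ = 1 ∧ val _ = 0 ∧ val _ = 0
  simp only [affinePullback_eq, map_add, pderiv_C_mul, pderiv_zero_affineSubst,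
      pderiv_one_affineSubst, map_mul, eval_C, val_affineSubst, b1]
  simp only [val] at e1 e2 e3 b2 b3 b4 ⊢
  refine ⟨?_, ?_, ?_, ?_, ?_, ?_⟩
  · rw [e2, e3]; ring
  · rw [e2, e3]; ring
  · linear_combination b2
  · rw [e1]; linear_combination b4
  · linear_combination B s 0 0 * b3
  · rw [e1]; linear_combination B s 0 0 * b3

/-! ### Conics in general position -/

/-- The coefficients of the quadratic form `a x² + b x y + e y² + g x z + h y z + f z²`. -/
structure Quad where
  a : ℂ
  b : ℂ
  e : ℂ
  g : ℂ
  h : ℂ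
  f : ℂ

namespace Quad

/-- The quadratic form as a polynomial. -/
noncomputable def toPoly (F : Quad) : Poly :=
  C F.a * X 0 ^ 2 + C F.b * X 0 * X 1 + C F.e * X 1 ^ 2 + C F.g * X 0 * X 2 + C F.h * X 1 * X 2
    + C F.f * X 2 ^ 2

theorem pderiv_zero_toPoly (F : Quad) :
    pderiv 0 F.toPoly = 2 * C F.a * X 0 + C F.b * X 1 + C F.g * X 2 := by
  simp [toPoly, pderiv_X]
  ring

theorem pderiv_one_toPoly (F : Quad) :
    pderiv 1 F.toPoly = C F.b * X 0 + 2 * C F.e * X 1 + C F.h * X 2 := by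
  simp [toPoly, pderiv_X]
  ring

theorem pderiv_two_toPoly (F : Quad) :
    pderiv 2 F.toPoly = C F.g * X 0 + C F.h * X 1 + 2 * C F.f * X 2 := by
  simp [toPoly, pderiv_X]
  ring

theorem isHomogeneous_toPoly (F : Quad) : F.toPoly.IsHomogeneous 2 := by
  have hX : ∀ i j : Fin 3, (X i * X j : Poly).IsHomogeneous 2 := fun i j =>
    (isHomogeneous_X ℂ i).mul (isHomogeneous_X ℂ j)
  have h : ∀ (r : ℂ) (i j : Fin 3), (C r * X i * X j : Poly).IsHomogeneous 2 := fun r i j => by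
    simpa [mul_assoc] using (isHomogeneous_C (Fin 3) r).mul (hX i j)
  simp only [toPoly, pow_two, ← mul_assoc]
  exact ((((h _ _ _).add (h _ _ _)).add (h _ _ _)).add (h _ _ _)).add (h _ _ _) |>.add (h _ _ _)

/-- Four times the determinant of the symmetric matrix of `F`. -/
def disc (F : Quad) : ℂ :=
  4 * F.a * F.e * F.f + F.b * F.g * F.h - F.a * F.h ^ 2 - F.e * F.g ^ 2 - F.f * F.b ^ 2

/-- The derivative of `disc` at `F` in the direction `G`; it is the coefficient of `μ² ν` in
`disc (μ F + ν G)`. -/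
def polar (F G : Quad) : ℂ :=
  (4 * F.e * F.f - F.h ^ 2) * G.a + (F.g * F.h - 2 * F.f * F.b) * G.b
    + (4 * F.a * F.f - F.g ^ 2) * G.e + (F.b * F.h - 2 * F.e * F.g) * G.g
    + (F.b * F.g - 2 * F.a * F.h) * G.h + (4 * F.a * F.e - F.b ^ 2) * G.f

/-- The value of the quadratic form at a vector. -/
def value (F : Quad) (v : Fin 3 → ℂ) : ℂ :=
  F.a * v 0 ^ 2 + F.b * v 0 * v 1 + F.e * v 1 ^ 2 + F.g * v 0 * v 2 + F.h * v 1 * v 2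
    + F.f * v 2 ^ 2

theorem eval_toPoly (F : Quad) (v : Fin 3 → ℂ) : eval v F.toPoly = F.value v := by
  simp [toPoly, value]

theorem grad_toPoly (F : Quad) (v : Fin 3 → ℂ) :
    grad F.toPoly v = ![2 * F.a * v 0 + F.b * v 1 + F.g * v 2,
      F.b * v 0 + 2 * F.e * v 1 + F.h * v 2, F.g * v 0 + F.h * v 1 + 2 * F.f * v 2] := by
  ext i
  fin_cases i <;> simp [grad, pderiv_zero_toPoly, pderiv_one_toPoly, pderiv_two_toPoly]

/-- The vanishing of the gradient of `F` at a nonzero vector `v`, in coordinates. -/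
def IsSingularAt (F : Quad) (v : Fin 3 → ℂ) : Prop :=
  2 * F.a * v 0 + F.b * v 1 + F.g * v 2 = 0 ∧
  F.b * v 0 + 2 * F.e * v 1 + F.h * v 2 = 0 ∧
  F.g * v 0 + F.h * v 1 + 2 * F.f * v 2 = 0

theorem disc_eq_zero {F : Quad} {v : Fin 3 → ℂ} (hv : v ≠ 0) (h : F.IsSingularAt v) :
    F.disc = 0 := by
  obtain ⟨h0, h1, h2⟩ := h
  by_contra hd
  apply hv
  unfold disc at hd
  ext i
  fin_cases i
  · change v 0 = 0
    refine (mul_eq_zero.1 ?_).resolve_left (mul_ne_zero two_ne_zero hd)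
    linear_combination (4 * F.e * F.f - F.h ^ 2) * h0 + (F.g * F.h - 2 * F.b * F.f) * h1
      + (F.b * F.h - 2 * F.e * F.g) * h2
  · change v 1 = 0
    refine (mul_eq_zero.1 ?_).resolve_left (mul_ne_zero two_ne_zero hd)
    linear_combination (F.g * F.h - 2 * F.b * F.f) * h0 + (4 * F.a * F.f - F.g ^ 2) * h1
      + (F.b * F.g - 2 * F.a * F.h) * h2
  · change v 2 = 0
    refine (mul_eq_zero.1 ?_).resolve_left (mul_ne_zero two_ne_zero hd)
    linear_combination (F.b * F.h - 2 * F.e * F.g) * h0 + (F.b * F.g - 2 * F.a * F.h) * h1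
      + (4 * F.a * F.e - F.b ^ 2) * h2

/-- At a singular point `v` of `F` the adjugate matrix is a multiple of `v vᵀ`, so the derivative of
the discriminant in the direction `G` is a multiple of the value of `G` at `v`. -/
theorem polar_eq_zero {F G : Quad} {v : Fin 3 → ℂ} (hv : v ≠ 0) (h : F.IsSingularAt v)
    (hG : G.value v = 0) : F.polar G = 0 := by
  obtain ⟨h0, h1, h2⟩ := h
  unfold value at hG
  unfold polar
  have hne : v 0 ≠ 0 ∨ v 1 ≠ 0 ∨ v 2 ≠ 0 := by
    by_contra! hc
    exact hv (by ext i; fin_cases i <;> simp [hc])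
  obtain ⟨a, b, e, g, k, f⟩ := F
  simp only at h0 h1 h2 ⊢
  generalize v 0 = x at *
  generalize v 1 = y at *
  generalize v 2 = z at *
  rcases hne with hx | hy | hz
  · obtain rfl : g = -(k * y + 2 * f * z) / x := by field_simp; linear_combination h2
    obtain rfl : b = -(2 * e * y + k * z) / x := by field_simp; linear_combination h1
    obtain rfl : a = -(-(2 * e * y + k * z) / x * y + -(k * y + 2 * f * z) / x * z) / (2 * x) := by
      field_simp
      field_simp at h0
      linear_combination h0
    field_simp
    linear_combination 2 * (4 * e * f - k ^ 2) * hG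
  · obtain rfl : k = -(g * x + 2 * f * z) / y := by field_simp; linear_combination h2
    obtain rfl : b = -(2 * a * x + g * z) / y := by field_simp; linear_combination h0
    obtain rfl : e = -(-(2 * a * x + g * z) / y * x + -(g * x + 2 * f * z) / y * z) / (2 * y) := by
      field_simp
      field_simp at h1
      linear_combination h1
    field_simp
    linear_combination 2 * (4 * a * f - g ^ 2) * hG
  · obtain rfl : g = -(2 * a * x + b * y) / z := by field_simp; linear_combination h0
    obtain rfl : k = -(b * x + 2 * e * y) / z := by field_simp; linear_combination h1
    obtain rfl : f = -(-(2 * a * x + b * y) / z * x + -(b * x + 2 * e * y) / z * y) / (2 * z) := by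
      field_simp
      field_simp at h2
      linear_combination h2
    field_simp
    linear_combination 2 * (4 * a * e - b ^ 2) * hG

end Quad

/-- The resultant of the binary quadratic forms `a x² + b x y + c y²` and `a' x² + b' x y + c' y²`.
-/
def binRes (a b c a' b' c' : ℂ) : ℂ :=
  (a * c' - a' * c) ^ 2 - (a * b' - a' * b) * (b * c' - b' * c)

theorem binRes_eq_zero {a b c a' b' c' x y : ℂ} (hxy : x ≠ 0 ∨ y ≠ 0)
    (h : a * x ^ 2 + b * x * y + c * y ^ 2 = 0) (h' : a' * x ^ 2 + b' * x * y + c' * y ^ 2 = 0) :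
    binRes a b c a' b' c' = 0 := by
  unfold binRes
  by_cases hy : y = 0
  · subst hy
    have hx : x ≠ 0 := by simpa using hxy
    have ha : a = 0 := by simpa [hx] using h
    have ha' : a' = 0 := by simpa [hx] using h'
    simp [ha, ha']
  · by_cases hx : x = 0
    · subst hx
      have hc : c = 0 := by simpa [hy] using h
      have hc' : c' = 0 := by simpa [hy] using h'
      simp [hc, hc']
    · have e1 : (a * b' - a' * b) * x + (a * c' - a' * c) * y = 0 := by
        apply (mul_eq_zero.1 _).resolve_left hy
        linear_combination a * h' - a' * h
      have e2 : (a * c' - a' * c) * x + (b * c' - b' * c) * y = 0 := by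
        apply (mul_eq_zero.1 _).resolve_left hx
        linear_combination c' * h - c * h'
      apply (mul_eq_zero.1 _).resolve_left hx
      linear_combination (a * c' - a' * c) * e2 - (b * c' - b' * c) * e1

/-- Up to a constant factor, the discriminant of the binary cubic
`disc (μ F + ν G) = disc F μ³ + polar F G μ² ν + polar G F μ ν² + disc G ν³`, as the resultant of its
partial derivatives. -/
def pencilDisc (F G : Quad) : ℂ :=
  binRes (3 * F.disc) (2 * F.polar G) (G.polar F) (F.polar G) (2 * G.polar F) (3 * G.disc)

/-- The polynomial conditions that ensure general position: both conics are smooth, both are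
transversal to the line at infinity, they do not meet there, and the pencil that they span has three
distinct singular members. -/
structure IsGeneric (F G : Quad) : Prop where
  smooth_left : F.disc ≠ 0
  smooth_right : G.disc ≠ 0
  infinity_left : 4 * F.a * F.e - F.b ^ 2 ≠ 0
  infinity_right : 4 * G.a * G.e - G.b ^ 2 ≠ 0
  resultant : binRes F.a F.b F.e G.a G.b G.e ≠ 0
  pencil : pencilDisc F G ≠ 0

theorem grad_ne_zero {F : Quad} (hF : F.disc ≠ 0) {v : Fin 3 → ℂ} (hv : v ≠ 0) :
    grad F.toPoly v ≠ 0 := by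
  intro h
  rw [Quad.grad_toPoly] at h
  exact hF (Quad.disc_eq_zero hv ⟨congrFun h 0, congrFun h 1, congrFun h 2⟩)

theorem toPoly_ne_zero {F : Quad} (hF : F.disc ≠ 0) : F.toPoly ≠ 0 := by
  intro h
  apply grad_ne_zero hF (v := ![0, 0, 1]) (fun h => by simpa using congrFun h 2)
  ext i
  simp [grad, h]

theorem fst_or_snd_ne_zero {v : Fin 3 → ℂ} (hv : v ≠ 0) (h2 : v 2 = 0) : v 0 ≠ 0 ∨ v 1 ≠ 0 := by
  by_contra! hc
  exact hv (by ext i; fin_cases i <;> simp [hc, h2])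

theorem not_tangent_infinity_of_ne_zero {F : Quad} (hF : 4 * F.a * F.e - F.b ^ 2 ≠ 0)
    {v : Fin 3 → ℂ} (hv : v ≠ 0) (h2 : v 2 = 0) :
    LinearIndependent ℂ ![grad F.toPoly v, ![0, 0, 1]] := by
  rw [LinearIndependent.pair_iff]
  intro s t hst
  rw [Quad.grad_toPoly] at hst
  have e0 : s * (2 * F.a * v 0 + F.b * v 1) = 0 := by simpa [h2] using congrFun hst 0
  have e1 : s * (F.b * v 0 + 2 * F.e * v 1) = 0 := by simpa [h2] using congrFun hst 1
  have hs : s = 0 := by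
    by_contra hs
    have e0' := (mul_eq_zero.1 e0).resolve_left hs
    have e1' := (mul_eq_zero.1 e1).resolve_left hs
    rcases fst_or_snd_ne_zero hv h2 with h | h
    · apply mul_ne_zero hF h
      linear_combination 2 * F.e * e0' - F.b * e1'
    · apply mul_ne_zero hF h
      linear_combination 2 * F.a * e1' - F.b * e0'
  refine ⟨hs, ?_⟩
  simpa [hs] using congrFun hst 2

/-- At a point of tangency some member of the pencil is singular; the derivatives of the
discriminant along the pencil vanish there, so the binary cubic has a multiple root. -/
theorem not_tangent_of_pencilDisc_ne_zero {F G : Quad} (h : pencilDisc F G ≠ 0) {v : Fin 3 → ℂ}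
    (hv : v ≠ 0) (hF : F.value v = 0) (hG : G.value v = 0) :
    LinearIndependent ℂ ![grad F.toPoly v, grad G.toPoly v] := by
  rw [LinearIndependent.pair_iff]
  intro s t hst
  by_contra hne
  rw [Quad.grad_toPoly, Quad.grad_toPoly] at hst
  have e0 := congrFun hst 0
  have e1 := congrFun hst 1
  have e2 := congrFun hst 2
  simp at e0 e1 e2
  set W : Quad := ⟨s * F.a + t * G.a, s * F.b + t * G.b, s * F.e + t * G.e, s * F.g + t * G.g,
    s * F.h + t * G.h, s * F.f + t * G.f⟩ with hW
  have hs : W.IsSingularAt v :=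
    ⟨by simp only [hW]; linear_combination e0, by simp only [hW]; linear_combination e1,
      by simp only [hW]; linear_combination e2⟩
  have p1 := Quad.polar_eq_zero hv hs hF
  have p2 := Quad.polar_eq_zero hv hs hG
  apply h
  refine binRes_eq_zero (x := s) (y := t) (by tauto) ?_ ?_
  · rw [← p1]
    simp only [Quad.disc, Quad.polar, hW]
    ring
  · rw [← p2]
    simp only [Quad.disc, Quad.polar, hW]
    ring

theorem pencilDisc_comm (F G : Quad) : pencilDisc G F = pencilDisc F G := by
  simp only [pencilDisc, binRes]
  ring

theorem IsGeneric.generalPosition {F G : Quad} (h : IsGeneric F G) :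
    GeneralPosition ![F.toPoly, G.toPoly] where
  smooth i v hv _ := by
    fin_cases i
    · exact grad_ne_zero h.smooth_left hv
    · exact grad_ne_zero h.smooth_right hv
  not_tangent_infinity i v hv h2 _ := by
    fin_cases i
    · exact not_tangent_infinity_of_ne_zero h.infinity_left hv h2
    · exact not_tangent_infinity_of_ne_zero h.infinity_right hv h2
  not_tangent i j hij v hv hi hj := by
    fin_cases i <;> fin_cases j
    · exact absurd rfl hij
    · exact not_tangent_of_pencilDisc_ne_zero h.pencil hv (F.eval_toPoly v ▸ hi)
        (G.eval_toPoly v ▸ hj)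
    · exact not_tangent_of_pencilDisc_ne_zero (pencilDisc_comm F G ▸ h.pencil) hv
        (G.eval_toPoly v ▸ hi) (F.eval_toPoly v ▸ hj)
    · exact absurd rfl hij
  not_meet_infinity i j hij v hv h2 hm := by
    have key : F.value v = 0 → G.value v = 0 → False := fun hF hG => by
      simp only [Quad.value, h2] at hF hG
      exact h.resultant (binRes_eq_zero (fst_or_snd_ne_zero hv h2)
        (by linear_combination hF) (by linear_combination hG))
    obtain ⟨hi, hj⟩ := hm
    fin_cases i <;> fin_cases j
    · exact absurd rfl hij
    · exact key (F.eval_toPoly v ▸ hi) (G.eval_toPoly v ▸ hj)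
    · exact key (F.eval_toPoly v ▸ hj) (G.eval_toPoly v ▸ hi)
    · exact absurd rfl hij
  not_three_meet i j k hij hjk hik := by omega

/-! ### Logarithmic forms of two conics -/

/-- The form `r G dF + s F dG`. -/
noncomputable def logForm (r s : ℂ) (F G : Quad) : Form :=
  (C r * (G.toPoly * pderiv 0 F.toPoly) + C s * (F.toPoly * pderiv 0 G.toPoly),
    C r * (G.toPoly * pderiv 1 F.toPoly) + C s * (F.toPoly * pderiv 1 G.toPoly))

theorem isHomogeneous_C_mul (r : ℂ) {p : Poly} {d : ℕ} (hp : p.IsHomogeneous d) :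
    (C r * p).IsHomogeneous d := by
  simpa using (isHomogeneous_C (Fin 3) r).mul hp

theorem logForm_mem_formsOfDegree (r s : ℂ) (F G : Quad) : logForm r s F G ∈ formsOfDegree 3 := by
  have h : ∀ (t : ℂ) (F G : Quad) (i : Fin 3),
      (C t * (G.toPoly * pderiv i F.toPoly)).IsHomogeneous 3 := fun t F G i =>
    isHomogeneous_C_mul t (G.isHomogeneous_toPoly.mul F.isHomogeneous_toPoly.pderiv)
  exact ⟨(h _ _ _ _).add (h _ _ _ _), (h _ _ _ _).add (h _ _ _ _)⟩

theorem logForm_mem_Y (r s : ℂ) {F G : Quad} (h : IsGeneric F G) :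
    logForm r s F G ∈ Y 3 ![2, 2] := by
  have hK : ∀ (t : ℂ) (F G : Quad), (C t * (pderiv 1 F.toPoly * pderiv 0 G.toPoly
      - pderiv 0 F.toPoly * pderiv 1 G.toPoly)).IsHomogeneous 2 := fun t F G =>
    isHomogeneous_C_mul t ((F.isHomogeneous_toPoly.pderiv.mul G.isHomogeneous_toPoly.pderiv).sub
      (F.isHomogeneous_toPoly.pderiv.mul G.isHomogeneous_toPoly.pderiv))
  refine ⟨logForm_mem_formsOfDegree r s F G, ![F.toPoly, G.toPoly], fun i => ?_,
    h.generalPosition⟩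
  fin_cases i
  · refine ⟨F.isHomogeneous_toPoly, toPoly_ne_zero h.smooth_left, _, hK s G F, ?_⟩
    simp [logForm]
    ring
  · refine ⟨G.isHomogeneous_toPoly, toPoly_ne_zero h.smooth_right, _, hK r F G, ?_⟩
    simp [logForm]
    ring

theorem val_logForm_fst (r s : ℂ) (F G : Quad) :
    val (logForm r s F G).1 = r * G.f * F.g + s * F.f * G.g := by
  simp [val, logForm, Quad.pderiv_zero_toPoly, Quad.eval_toPoly, Quad.value]
  ring

theorem val_logForm_snd (r s : ℂ) (F G : Quad) :
    val (logForm r s F G).2 = r * G.f * F.h + s * F.f * G.h := by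
  simp [val, logForm, Quad.pderiv_one_toPoly, Quad.eval_toPoly, Quad.value]
  ring

theorem val_pderiv_logForm_sub (r s : ℂ) (F G : Quad) :
    val (pderiv 0 (logForm r s F G).2) - val (pderiv 1 (logForm r s F G).1)
      = (s - r) * (F.g * G.h - F.h * G.g) := by
  simp [val, logForm, Quad.pderiv_zero_toPoly, Quad.pderiv_one_toPoly, Quad.eval_toPoly,
    Quad.value, pderiv_X]
  ring

/-! ### Perturbation of the conics -/

theorem eventually_ne_zero_of_differentiable {φ : ℂ → ℂ} (hφ : Differentiable ℂ φ) {w : ℂ}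
    (hw : φ w ≠ 0) : ∀ᶠ s in 𝓝[≠] (0 : ℂ), φ s ≠ 0 := by
  by_contra h
  have h' : ∃ᶠ s in 𝓝[≠] (0 : ℂ), φ s = 0 := by
    rw [Filter.not_eventually] at h
    exact h.mono fun s hs => not_not.1 hs
  exact hw ((AnalyticOnNhd.eqOn_zero_of_preconnected_of_frequently_eq_zero
    (fun z _ => hφ.analyticAt z) isPreconnected_univ (Set.mem_univ 0) h') (Set.mem_univ w))

/-- The segment from `F` to `F'`. -/
def Quad.lerp (F F' : Quad) (s : ℂ) : Quad :=
  ⟨(1 - s) * F.a + s * F'.a, (1 - s) * F.b + s * F'.b, (1 - s) * F.e + s * F'.e,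
    (1 - s) * F.g + s * F'.g, (1 - s) * F.h + s * F'.h, (1 - s) * F.f + s * F'.f⟩

theorem Quad.lerp_one (F F' : Quad) : F.lerp F' 1 = F' := by
  simp [Quad.lerp]

theorem IsGeneric.eventually_lerp {F' G' : Quad} (h : IsGeneric F' G') (F G : Quad) :
    ∀ᶠ s in 𝓝[≠] (0 : ℂ), IsGeneric (F.lerp F' s) (G.lerp G' s) := by
  have hd : ∀ F F' : Quad, Differentiable ℂ fun s => (F.lerp F' s).disc := fun F F' => by
    simp only [Quad.lerp, Quad.disc]
    fun_prop
  have hp : ∀ F F' G G' : Quad, Differentiable ℂ fun s => (F.lerp F' s).polar (G.lerp G' s) :=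
    fun F F' G G' => by
      simp only [Quad.lerp, Quad.polar]
      fun_prop
  have h1 := eventually_ne_zero_of_differentiable (hd F F') (w := 1)
    (by simpa only [Quad.lerp_one] using h.smooth_left)
  have h2 := eventually_ne_zero_of_differentiable (hd G G') (w := 1)
    (by simpa only [Quad.lerp_one] using h.smooth_right)
  have hi : ∀ F F' : Quad, Differentiable ℂ
      fun s => 4 * (F.lerp F' s).a * (F.lerp F' s).e - (F.lerp F' s).b ^ 2 := fun F F' => by
    simp only [Quad.lerp]
    fun_prop
  have h3 := eventually_ne_zero_of_differentiable (hi F F') (w := 1)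
    (by simpa only [Quad.lerp_one] using h.infinity_left)
  have h4 := eventually_ne_zero_of_differentiable (hi G G') (w := 1)
    (by simpa only [Quad.lerp_one] using h.infinity_right)
  have h5 := eventually_ne_zero_of_differentiable (φ := fun s =>
      binRes (F.lerp F' s).a (F.lerp F' s).b (F.lerp F' s).e (G.lerp G' s).a (G.lerp G' s).b
        (G.lerp G' s).e) (by simp only [Quad.lerp, binRes]; fun_prop) (w := 1)
    (by simpa only [Quad.lerp_one] using h.resultant)
  have h6 := eventually_ne_zero_of_differentiable
    (φ := fun s => pencilDisc (F.lerp F' s) (G.lerp G' s)) (by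
      have d1 := hd F F'
      have d2 := hp F F' G G'
      have d3 := hp G G' F F'
      have d4 := hd G G'
      simp only [pencilDisc, binRes]
      fun_prop) (w := 1) (by simpa only [Quad.lerp_one] using h.pencil)
  filter_upwards [h1, h2, h3, h4, h5, h6] with s a1 a2 a3 a4 a5 a6
  exact ⟨a1, a2, a3, a4, a5, a6⟩

theorem tendsto_lerp (p q : ℂ) : Tendsto (fun s : ℂ => (1 - s) * p + s * q) (𝓝[≠] 0) (𝓝 p) := by
  have h : Continuous fun s : ℂ => (1 - s) * p + s * q := by fun_prop
  simpa using (h.tendsto 0).mono_left nhdsWithin_le_nhds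

theorem coeffTendsto_lerp (F F' : Quad) :
    CoeffTendsto (fun s => (F.lerp F' s).toPoly) F.toPoly := by
  have h : ∀ p q : ℂ, CoeffTendsto (fun s => C ((1 - s) * p + s * q)) (C p) := fun p q =>
    .C (tendsto_lerp p q)
  exact ((((((h _ _).mul (.const _)).add (((h _ _).mul (.const _)).mul (.const _))).add
    ((h _ _).mul (.const _))).add (((h _ _).mul (.const _)).mul (.const _))).add
    (((h _ _).mul (.const _)).mul (.const _))).add ((h _ _).mul (.const _))

theorem coeffTendsto_pderiv {p : ℂ → Poly} {q : Poly} (h : CoeffTendsto p q) (i : Fin 3) :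
    CoeffTendsto (fun s => pderiv i (p s)) (pderiv i q) := fun u => by
  simp only [coeff_pderiv]
  exact (h _).mul_const _

/-- Whether the base point is critical with symmetric linear part depends only on the values and
gradients of the two conics there. So the coefficients of `x²`, `x y` and `y²` may be perturbed, and a
single generic pair with the given lower coefficients is enough. -/
theorem isGood_logForm_of_isGeneric {r s : ℂ} {F G F' G' : Quad} (h : IsGeneric F' G')
    (hFg : F'.g = F.g) (hFh : F'.h = F.h) (hFf : F'.f = F.f)
    (hGg : G'.g = G.g) (hGh : G'.h = G.h) (hGf : G'.f = G.f)
    (hx : r * G.f * F.g + s * F.f * G.g = 0) (hy : r * G.f * F.h + s * F.f * G.h = 0)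
    (hs : (s - r) * (F.g * G.h - F.h * G.g) = 0) : IsGood (logForm r s F G) := by
  have low : ∀ p q t : ℂ, q = p → (1 - t) * p + t * q = p := fun p q t e => by rw [e]; ring
  have tF := coeffTendsto_lerp F F'
  have tG := coeffTendsto_lerp G G'
  have lim : ∀ i, CoeffTendsto (fun t => C r * ((G.lerp G' t).toPoly
      * pderiv i (F.lerp F' t).toPoly) + C s * ((F.lerp F' t).toPoly
      * pderiv i (G.lerp G' t).toPoly)) (C r * (G.toPoly * pderiv i F.toPoly)
      + C s * (F.toPoly * pderiv i G.toPoly)) := fun i =>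
    ((CoeffTendsto.const _).mul (tG.mul (coeffTendsto_pderiv tF i))).add
      ((CoeffTendsto.const _).mul (tF.mul (coeffTendsto_pderiv tG i)))
  refine IsGood.of_tendsto (η := fun t => logForm r s (F.lerp F' t) (G.lerp G' t))
    (fun t => logForm_mem_formsOfDegree _ _ _ _) (logForm_mem_formsOfDegree _ _ _ _)
    (lim 0) (lim 1) (fun t => ?_) (fun t => ?_) (fun t => ?_) ?_
  · rw [val_logForm_fst]
    simp only [Quad.lerp, low _ _ t hFg, low _ _ t hFf, low _ _ t hGg, low _ _ t hGf]
    exact hx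
  · rw [val_logForm_snd]
    simp only [Quad.lerp, low _ _ t hFh, low _ _ t hFf, low _ _ t hGh, low _ _ t hGf]
    exact hy
  · symm
    rw [← sub_eq_zero, val_pderiv_logForm_sub]
    simp only [Quad.lerp, low _ _ t hFg, low _ _ t hFh, low _ _ t hGg, low _ _ t hGh]
    exact hs
  · filter_upwards [h.eventually_lerp F G] with t ht
    exact isGood_of_mem_Y (logForm_mem_Y r s ht)

/-- Two conics that do not pass through the base point can be made generic by a change of their
leading coefficients. After the scaling `x, y ↦ ε x, ε y` the linear terms become small, and in the
limit the two conics are `f (x² + y² + z²)` and `f' (2 x² + 3 y² + z²)`. -/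
theorem exists_isGeneric_of_ne_zero {f f' : ℂ} (hf : f ≠ 0) (hf' : f' ≠ 0) (g h g' h' : ℂ) :
    ∃ a b e a' b' e' : ℂ, IsGeneric ⟨a, b, e, g, h, f⟩ ⟨a', b', e', g', h', f'⟩ := by
  set F : ℂ → Quad := fun ε => ⟨f, 0, f, ε * g, ε * h, f⟩ with hF
  set G : ℂ → Quad := fun ε => ⟨2 * f', 0, 3 * f', ε * g', ε * h', f'⟩ with hG
  have c1 : Continuous fun ε => (F ε).disc := by simp only [hF, Quad.disc]; fun_prop
  have c2 : Continuous fun ε => (G ε).disc := by simp only [hG, Quad.disc]; fun_prop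
  have c3 : Continuous fun ε => pencilDisc (F ε) (G ε) := by
    simp only [hF, hG, Quad.disc, Quad.polar, pencilDisc, binRes]; fun_prop
  have d1 : (F 0).disc ≠ 0 := by simp [hF, Quad.disc, hf]
  have d2 : (G 0).disc ≠ 0 := by simp [hG, Quad.disc, hf']
  have d3 : pencilDisc (F 0) (G 0) ≠ 0 := by
    have : pencilDisc (F 0) (G 0) = -3072 * (f * f') ^ 6 := by
      simp only [hF, hG, Quad.disc, Quad.polar, pencilDisc, binRes]; ring
    rw [this]
    simp [hf, hf']
  obtain ⟨ε, e1, e2, e3, hε⟩ := ((((c1.tendsto 0).eventually_ne d1).filter_mono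
    (nhdsWithin_le_nhds (s := {0}ᶜ))).and ((((c2.tendsto 0).eventually_ne d2).filter_mono
    nhdsWithin_le_nhds).and ((((c3.tendsto 0).eventually_ne d3).filter_mono
    nhdsWithin_le_nhds).and eventually_mem_nhdsWithin))).exists
  have hε : ε ≠ 0 := by simpa using hε
  refine ⟨f / ε ^ 2, 0, f / ε ^ 2, 2 * f' / ε ^ 2, 0, 3 * f' / ε ^ 2, ?_, ?_, ?_, ?_, ?_, ?_⟩
  · intro h0
    apply e1
    simp only [hF, Quad.disc] at h0 ⊢
    field_simp at h0
    linear_combination h0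
  · intro h0
    apply e2
    simp only [hG, Quad.disc] at h0 ⊢
    field_simp at h0
    linear_combination h0
  · simp [hf, hε]
  · simp [hf', hε]
  · simp only [binRes]
    have : (f / ε ^ 2 * (3 * f' / ε ^ 2) - 2 * f' / ε ^ 2 * (f / ε ^ 2)) ^ 2
        - (f / ε ^ 2 * 0 - 2 * f' / ε ^ 2 * 0) * (0 * (3 * f' / ε ^ 2) - 0 * (f / ε ^ 2))
        = (f * f' / ε ^ 4) ^ 2 := by
      field_simp
      ring
    rw [this]
    simp [hf, hf', hε]
  · intro h0
    apply e3
    have s1 : (F ε).disc = ε ^ 4 * (⟨f / ε ^ 2, 0, f / ε ^ 2, g, h, f⟩ : Quad).disc := by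
      simp only [hF, Quad.disc]; field_simp; ring
    have s2 : (G ε).disc =
        ε ^ 4 * (⟨2 * f' / ε ^ 2, 0, 3 * f' / ε ^ 2, g', h', f'⟩ : Quad).disc := by
      simp only [hG, Quad.disc]; field_simp; ring
    have s3 : (F ε).polar (G ε) = ε ^ 4 * (⟨f / ε ^ 2, 0, f / ε ^ 2, g, h, f⟩ : Quad).polar
        ⟨2 * f' / ε ^ 2, 0, 3 * f' / ε ^ 2, g', h', f'⟩ := by
      simp only [hF, hG, Quad.polar]; field_simp; ring
    have s4 : (G ε).polar (F ε) = ε ^ 4 * (⟨2 * f' / ε ^ 2, 0, 3 * f' / ε ^ 2, g', h', f'⟩ :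
        Quad).polar ⟨f / ε ^ 2, 0, f / ε ^ 2, g, h, f⟩ := by
      simp only [hF, hG, Quad.polar]; field_simp; ring
    simp only [pencilDisc, binRes, s1, s2, s3, s4] at h0 ⊢
    linear_combination ε ^ 16 * h0

/-- Two conics that meet transversally at the base point can be made generic by a change of their
leading coefficients: in terms of the two tangent forms `u` and `v` the pair
`u z + u² + v²`, `v z + u² + 2 v²` is generic. -/
theorem exists_isGeneric_of_transversal {g h g' h' : ℂ} (hgh : g * h' - h * g' ≠ 0) :
    ∃ a b e a' b' e' : ℂ, IsGeneric ⟨a, b, e, g, h, 0⟩ ⟨a', b', e', g', h', 0⟩ := by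
  set F : Quad := ⟨g ^ 2 + g' ^ 2, 2 * (g * h + g' * h'), h ^ 2 + h' ^ 2, g, h, 0⟩ with hF
  set G : Quad :=
    ⟨g ^ 2 + 2 * g' ^ 2, 2 * (g * h + 2 * (g' * h')), h ^ 2 + 2 * h' ^ 2, g', h', 0⟩ with hG
  have s1 : F.disc = -(g * h' - h * g') ^ 2 := by simp only [hF, Quad.disc]; ring
  have s2 : G.disc = -(g * h' - h * g') ^ 2 := by simp only [hG, Quad.disc]; ring
  have s3 : F.polar G = -2 * (g * h' - h * g') ^ 2 := by simp only [hF, hG, Quad.polar]; ring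
  have s4 : G.polar F = -(g * h' - h * g') ^ 2 := by simp only [hF, hG, Quad.polar]; ring
  refine ⟨_, _, _, _, _, _, (?_ : IsGeneric F G)⟩
  refine ⟨?_, ?_, ?_, ?_, ?_, ?_⟩
  · rw [s1]; simp [hgh]
  · rw [s2]; simp [hgh]
  · have : 4 * F.a * F.e - F.b ^ 2 = 4 * (g * h' - h * g') ^ 2 := by simp only [hF]; ring
    rw [this]; simp [hgh]
  · have : 4 * G.a * G.e - G.b ^ 2 = 8 * (g * h' - h * g') ^ 2 := by simp only [hG]; ring
    rw [this]; simp [hgh]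
  · have : binRes F.a F.b F.e G.a G.b G.e = (g * h' - h * g') ^ 4 := by
      simp only [hF, hG, binRes]; ring
    rw [this]; simp [hgh]
  · have : pencilDisc F G = 69 * (g * h' - h * g') ^ 8 := by
      simp only [pencilDisc, binRes, s1, s2, s3, s4]; ring
    rw [this]; simp [hgh]

/-- The critical point lies on neither conic. -/
theorem isGood_logForm_of_ne_zero {r s : ℂ} {F G : Quad} (hF : F.f ≠ 0) (hG : G.f ≠ 0)
    (hx : r * G.f * F.g + s * F.f * G.g = 0) (hy : r * G.f * F.h + s * F.f * G.h = 0) :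
    IsGood (logForm r s F G) := by
  obtain ⟨a, b, e, a', b', e', h⟩ := exists_isGeneric_of_ne_zero hF hG F.g F.h G.g G.h
  refine isGood_logForm_of_isGeneric h rfl rfl rfl rfl rfl rfl hx hy ?_
  have h1 : r * (F.g * G.h - F.h * G.g) = 0 := by
    apply (mul_eq_zero.1 _).resolve_left hG
    linear_combination G.h * hx - G.g * hy
  have h2 : s * (F.g * G.h - F.h * G.g) = 0 := by
    apply (mul_eq_zero.1 _).resolve_left hF
    linear_combination F.g * hy - F.h * hx
  linear_combination h2 - h1

/-- The critical point is a transversal intersection point of the conics, and the form is exact. -/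
theorem isGood_logForm_of_transversal {F G : Quad} (hF : F.f = 0) (hG : G.f = 0)
    (hgh : F.g * G.h - F.h * G.g ≠ 0) : IsGood (logForm 1 1 F G) := by
  obtain ⟨a, b, e, a', b', e', h⟩ := exists_isGeneric_of_transversal hgh
  refine isGood_logForm_of_isGeneric h rfl rfl hF.symm rfl rfl hG.symm ?_ ?_ ?_
  all_goals simp [hF, hG]

/-! ### Pullbacks of affine-linear forms -/

/-- The quadratic form `l₀ z² + l₁ U + l₂ V`, where `U = x² + ρ x z` and
`V = x y + ξ y z + ζ x z`. -/
def uvQuad (ρ ξ ζ : ℂ) (l : Fin 3 → ℂ) : Quad :=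
  ⟨l 1, l 2, 0, l 1 * ρ + l 2 * ζ, l 2 * ξ, l 0⟩

/-- The form `(α₀ + α₁ U + α₂ V) dU + (β₀ + β₁ U + β₂ V) dV`, where `U = x² + ρ x` and
`V = x y + ξ y + ζ x`, homogenized with `z`. -/
noncomputable def uvForm (ρ ξ ζ : ℂ) (α β : Fin 3 → ℂ) : Form :=
  ((uvQuad ρ ξ ζ α).toPoly * (2 * X 0 + C ρ * X 2) + (uvQuad ρ ξ ζ β).toPoly * (X 1 + C ζ * X 2),
    (uvQuad ρ ξ ζ β).toPoly * (X 0 + C ξ * X 2))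

theorem uvForm_mem_formsOfDegree (ρ ξ ζ : ℂ) (α β : Fin 3 → ℂ) :
    uvForm ρ ξ ζ α β ∈ formsOfDegree 3 := by
  have hX := isHomogeneous_X (R := ℂ) (σ := Fin 3)
  have h1 : (2 * X 0 + C ρ * X 2 : Poly).IsHomogeneous 1 :=
    (isHomogeneous_C_mul 2 (hX 0)).add (isHomogeneous_C_mul ρ (hX 2))
  have h2 : ∀ (i : Fin 3) (r : ℂ), (X i + C r * X 2 : Poly).IsHomogeneous 1 := fun i r =>
    (hX i).add (isHomogeneous_C_mul r (hX 2))
  have hq := fun l => (uvQuad ρ ξ ζ l).isHomogeneous_toPoly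
  exact ⟨((hq _).mul h1).add ((hq _).mul (h2 _ _)), (hq _).mul (h2 _ _)⟩

theorem val_uvForm_fst (ρ ξ ζ : ℂ) (α β : Fin 3 → ℂ) :
    val (uvForm ρ ξ ζ α β).1 = α 0 * ρ + β 0 * ζ := by
  simp [val, uvForm, Quad.eval_toPoly, Quad.value, uvQuad]

theorem val_uvForm_snd (ρ ξ ζ : ℂ) (α β : Fin 3 → ℂ) :
    val (uvForm ρ ξ ζ α β).2 = β 0 * ξ := by
  simp [val, uvForm, Quad.eval_toPoly, Quad.value, uvQuad]

theorem pderiv_const_two (i : Fin 3) : pderiv i (2 : Poly) = 0 := pderiv_C (a := (2 : ℂ))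

theorem val_pderiv_zero_uvForm_fst (ρ ξ ζ : ℂ) (α β : Fin 3 → ℂ) :
    val (pderiv 0 (uvForm ρ ξ ζ α β).1) =
      (α 1 * ρ + α 2 * ζ) * ρ + 2 * α 0 + (β 1 * ρ + β 2 * ζ) * ζ := by
  simp [val, uvForm, Quad.eval_toPoly, Quad.value, uvQuad, Quad.pderiv_zero_toPoly, pderiv_X,
    pderiv_const_two]
  ring

theorem val_pderiv_one_uvForm_fst (ρ ξ ζ : ℂ) (α β : Fin 3 → ℂ) :
    val (pderiv 1 (uvForm ρ ξ ζ α β).1) = α 2 * ξ * ρ + β 2 * ξ * ζ + β 0 := by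
  simp [val, uvForm, Quad.eval_toPoly, Quad.value, uvQuad, Quad.pderiv_one_toPoly, pderiv_X,
    pderiv_const_two]
  ring

theorem val_pderiv_zero_uvForm_snd (ρ ξ ζ : ℂ) (α β : Fin 3 → ℂ) :
    val (pderiv 0 (uvForm ρ ξ ζ α β).2) = (β 1 * ρ + β 2 * ζ) * ξ + β 0 := by
  simp [val, uvForm, Quad.eval_toPoly, Quad.value, uvQuad, Quad.pderiv_zero_toPoly, pderiv_X]
  ring

theorem val_pderiv_one_uvForm_snd (ρ ξ ζ : ℂ) (α β : Fin 3 → ℂ) :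
    val (pderiv 1 (uvForm ρ ξ ζ α β).2) = β 2 * ξ ^ 2 := by
  simp [val, uvForm, uvQuad, Quad.pderiv_one_toPoly, pderiv_X]
  ring

/-- A decomposition `α dU + β dV = r L' dL + s L dL'` of the affine-linear form, with
`L = l₀ + l₁ U + l₂ V` and `L' = l'₀ + l'₁ U + l'₂ V`, pulls back to a logarithmic form of two
conics. -/
theorem uvForm_eq_logForm (ρ ξ ζ r s : ℂ) {α β l l' : Fin 3 → ℂ}
    (hα : ∀ i, α i = r * l' i * l 1 + s * l i * l' 1)
    (hβ : ∀ i, β i = r * l' i * l 2 + s * l i * l' 2) :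
    uvForm ρ ξ ζ α β = logForm r s (uvQuad ρ ξ ζ l) (uvQuad ρ ξ ζ l') := by
  have d0 : ∀ l, pderiv 0 (uvQuad ρ ξ ζ l).toPoly =
      C (l 1) * (2 * X 0 + C ρ * X 2) + C (l 2) * (X 1 + C ζ * X 2) := fun l => by
    simp only [Quad.pderiv_zero_toPoly, uvQuad, C_add, C_mul]
    ring
  have d1 : ∀ l, pderiv 1 (uvQuad ρ ξ ζ l).toPoly = C (l 2) * (X 0 + C ξ * X 2) := fun l => by
    simp only [Quad.pderiv_one_toPoly, uvQuad, C_mul, C_0]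
    ring
  have e : ∀ (p q : ℂ) (γ : Fin 3 → ℂ), (∀ i, γ i = r * l' i * p + s * l i * q) →
      (uvQuad ρ ξ ζ γ).toPoly = C (r * p) * (uvQuad ρ ξ ζ l').toPoly
        + C (s * q) * (uvQuad ρ ξ ζ l).toPoly := fun p q γ h => by
    simp only [Quad.toPoly, uvQuad, h, C_add, C_mul, C_0]
    ring
  rw [uvForm, logForm, d0, d0, d1, d1, e _ _ α hα, e _ _ β hβ]
  simp only [C_mul]
  ext1
  · ring
  · ring

/-! ### Affine-linear forms in the plane -/

/-- The determinant of the matrix `[[-β₁, α₁], [-β₂, α₂]]` whose eigenvectors `(l₁, l₂)` are the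
directions of the invariant lines `l₀ + l₁ U + l₂ V = 0` of the form
`(α₀ + α₁ U + α₂ V) dU + (β₀ + β₁ U + β₂ V) dV`. -/
def lineDet (α β : Fin 3 → ℂ) : ℂ := α 1 * β 2 - α 2 * β 1

/-- The discriminant of the characteristic polynomial of the matrix of `lineDet`. -/
def lineDisc (α β : Fin 3 → ℂ) : ℂ := (α 2 - β 1) ^ 2 - 4 * lineDet α β

/-- This vanishes if and only if `(α₀, β₀)` and its image under the matrix of `lineDet` are
proportional, that is, if an invariant line may pass through the origin. -/
def lineCross (α β : Fin 3 → ℂ) : ℂ :=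
  α 1 * β 0 ^ 2 - (β 1 + α 2) * α 0 * β 0 + β 2 * α 0 ^ 2

/-- An eigenvalue `κ` of the linear part gives an invariant line with constant cofactor `κ`. -/
theorem exists_invariant_line {α β : Fin 3 → ℂ} {κ : ℂ} (hκ : κ ≠ 0)
    (hroot : κ ^ 2 - (α 2 - β 1) * κ + lineDet α β = 0) (hc : lineCross α β ≠ 0) :
    ∃ l : Fin 3 → ℂ, l 0 ≠ 0 ∧ ∀ i, α i * l 2 - β i * l 1 = κ * l i := by
  have hdet : (!![-β 1 - κ, α 1; -β 2, α 2 - κ] : Matrix (Fin 2) (Fin 2) ℂ).det = 0 := by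
    rw [Matrix.det_fin_two_of, ← hroot, lineDet]
    ring
  obtain ⟨w, hw, hMw⟩ := Matrix.exists_mulVec_eq_zero_iff.2 hdet
  have h0 := congrFun hMw 0
  have h1 := congrFun hMw 1
  simp [Matrix.mulVec, dotProduct, Fin.sum_univ_two] at h0 h1
  have hw' : w 0 ≠ 0 ∨ w 1 ≠ 0 := by
    by_contra! h
    exact hw (by ext i; fin_cases i <;> simp [h])
  refine ⟨![(α 0 * w 1 - β 0 * w 0) / κ, w 0, w 1], ?_, ?_⟩
  · simp only [Matrix.cons_val_zero]
    refine div_ne_zero (fun h => hc ?_) hκ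
    unfold lineCross
    rcases hw' with hw | hw
    · apply (mul_eq_zero.1 _).resolve_left (pow_ne_zero 2 hw)
      linear_combination (-α 1 * (β 0 * w 0 + α 0 * w 1) + (β 1 + α 2) * α 0 * w 0) * h
        + α 0 ^ 2 * w 1 * h0 - α 0 ^ 2 * w 0 * h1
    · apply (mul_eq_zero.1 _).resolve_left (pow_ne_zero 2 hw)
      linear_combination (β 2 * (α 0 * w 1 + β 0 * w 0) - (β 1 + α 2) * β 0 * w 1) * h
        + β 0 ^ 2 * w 1 * h0 - β 0 ^ 2 * w 0 * h1
  · intro i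
    fin_cases i
    · simp
      field_simp
    · simp
      linear_combination h0
    · simp
      linear_combination h1

/-- The generic form with a critical point at the base point: the affine-linear form has two
invariant lines, none of which passes through the origin. -/
theorem isGood_uvForm_of_generic {ρ ξ ζ : ℂ} {α β : Fin 3 → ℂ} (h1 : lineDet α β ≠ 0)
    (h2 : lineDisc α β ≠ 0) (h3 : lineCross α β ≠ 0) (hP : α 0 * ρ + β 0 * ζ = 0)
    (hQ : β 0 * ξ = 0) : IsGood (uvForm ρ ξ ζ α β) := by
  obtain ⟨δ, hδ⟩ := IsAlgClosed.exists_pow_nat_eq (lineDisc α β) (n := 2) two_pos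
  have hδ0 : δ ≠ 0 := fun h => h2 (by rw [← hδ, h]; ring)
  unfold lineDisc at hδ
  have root : ∀ ε : ℂ, ε ^ 2 = δ ^ 2 → (((α 2 - β 1) + ε) / 2) ^ 2
      - (α 2 - β 1) * (((α 2 - β 1) + ε) / 2) + lineDet α β = 0 := fun ε hε => by
    rw [hδ] at hε
    linear_combination hε / 4
  have ne : ∀ κ : ℂ, κ ^ 2 - (α 2 - β 1) * κ + lineDet α β = 0 → κ ≠ 0 := by
    rintro κ hκ rfl
    exact h1 (by linear_combination hκ)
  have r1 := root δ rfl
  have r2 := root (-δ) (neg_sq δ)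
  have hκ : ((α 2 - β 1) + δ) / 2 ≠ ((α 2 - β 1) + -δ) / 2 := fun h =>
    hδ0 (by linear_combination h)
  generalize ((α 2 - β 1) + δ) / 2 = κ at *
  generalize ((α 2 - β 1) + -δ) / 2 = κ' at *
  obtain ⟨l, hl, el⟩ := exists_invariant_line (ne κ r1) r1 h3
  obtain ⟨l', hl', el'⟩ := exists_invariant_line (ne κ' r2) r2 h3
  -- eigenvectors for different eigenvalues are independent
  have hD : l 1 * l' 2 - l 2 * l' 1 ≠ 0 := by
    intro hD
    have hk : κ - κ' ≠ 0 := sub_ne_zero.2 hκ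
    have p11 : l 1 * l' 1 = 0 := by
      apply (mul_eq_zero.1 _).resolve_left hk
      linear_combination l 1 * el' 1 - l' 1 * el 1 - α 1 * hD
    have p22 : l 2 * l' 2 = 0 := by
      apply (mul_eq_zero.1 _).resolve_left hk
      linear_combination l 2 * el' 2 - l' 2 * el 2 - β 2 * hD
    have p12 : l 1 * l' 2 = 0 := by
      apply (mul_eq_zero.1 _).resolve_left hk
      linear_combination l 2 * el' 1 - l' 2 * el 1 - (β 1 + κ') * hD
    have p21 : l 2 * l' 1 = 0 := by linear_combination p12 - hD
    have z : l 1 = 0 ∧ l 2 = 0 ∨ l' 1 = 0 ∧ l' 2 = 0 := by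
      rw [mul_eq_zero] at p11 p12 p21 p22
      tauto
    rcases z with ⟨z1, z2⟩ | ⟨z1, z2⟩
    · exact mul_ne_zero (ne κ r1) hl (by rw [← el 0, z1, z2]; ring)
    · exact mul_ne_zero (ne κ' r2) hl' (by rw [← el' 0, z1, z2]; ring)
  have e := uvForm_eq_logForm ρ ξ ζ (κ' / (l 1 * l' 2 - l 2 * l' 1))
    (-κ / (l 1 * l' 2 - l 2 * l' 1)) (α := α) (β := β) (l := l) (l' := l')
    (fun i => by field_simp; linear_combination l 1 * el' i - l' 1 * el i)
    (fun i => by field_simp; linear_combination l 2 * el' i - l' 2 * el i)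
  have v1 := val_uvForm_fst ρ ξ ζ α β
  have v2 := val_uvForm_snd ρ ξ ζ α β
  rw [e] at v1 v2 ⊢
  refine isGood_logForm_of_ne_zero hl hl' ?_ ?_
  · rw [← val_logForm_fst, v1, hP]
  · rw [← val_logForm_snd, v2, hQ]

theorem coeffTendsto_uvQuad (ρ ξ ζ : ℂ) (l l' : Fin 3 → ℂ) :
    CoeffTendsto (fun s => (uvQuad ρ ξ ζ fun i => (1 - s) * l i + s * l' i).toPoly)
      (uvQuad ρ ξ ζ l).toPoly := by
  have h : (fun s => (uvQuad ρ ξ ζ fun i => (1 - s) * l i + s * l' i).toPoly) =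
      fun s => ((uvQuad ρ ξ ζ l).lerp (uvQuad ρ ξ ζ l') s).toPoly := by
    funext s
    congr 1
    simp only [uvQuad, Quad.lerp, Quad.mk.injEq]
    refine ⟨trivial, trivial, ?_, ?_, ?_, trivial⟩ <;> ring
  rw [h]
  exact coeffTendsto_lerp _ _

/-- The critical point lies on one of the two lines along which `(U, V)` fails to be a local
coordinate system. The linear part of the affine-linear form can be perturbed freely. -/
theorem isGood_uvForm_of_ramified {ρ ξ ζ : ℂ} {α β : Fin 3 → ℂ} (hρξ : ρ * ξ = 0)
    (h0 : α 0 ≠ 0 ∨ β 0 ≠ 0) (hP : α 0 * ρ + β 0 * ζ = 0) (hQ : β 0 * ξ = 0) :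
    IsGood (uvForm ρ ξ ζ α β) := by
  -- a generic linear part for the given constant terms; two choices are needed to avoid that
  -- `(α₀, β₀)` is an eigenvector
  obtain ⟨α', β', hα', hβ', h1, h2, h3⟩ : ∃ α' β' : Fin 3 → ℂ, α' 0 = α 0 ∧ β' 0 = β 0 ∧
      lineDet α' β' ≠ 0 ∧ lineDisc α' β' ≠ 0 ∧ lineCross α' β' ≠ 0 := by
    by_cases h : α 0 * β 0 = 0
    · refine ⟨![α 0, 1, 0], ![β 0, 0, -2], rfl, rfl, ?_, ?_, ?_⟩
      · simp [lineDet]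
      · simp [lineDisc, lineDet]
      · rcases mul_eq_zero.1 h with h | h
        · have : β 0 ≠ 0 := by tauto
          simp [lineCross, h, this]
        · have : α 0 ≠ 0 := by tauto
          simp [lineCross, h, this]
    · refine ⟨![α 0, 0, 2], ![β 0, -1, 0], rfl, rfl, ?_, ?_, ?_⟩
      · simp [lineDet]
      · simp [lineDisc, lineDet]
        norm_num
      · have : lineCross ![α 0, 0, 2] ![β 0, -1, 0] = -(α 0 * β 0) := by
          simp only [lineCross, Matrix.cons_val]
          ring
        rw [this]
        exact neg_ne_zero.2 h
  have low : ∀ p q t : ℂ, q = p → (1 - t) * p + t * q = p := fun p q t e => by rw [e]; ring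
  have tα := coeffTendsto_uvQuad ρ ξ ζ α α'
  have tβ := coeffTendsto_uvQuad ρ ξ ζ β β'
  refine IsGood.of_tendsto (η := fun s => uvForm ρ ξ ζ (fun i => (1 - s) * α i + s * α' i)
      (fun i => (1 - s) * β i + s * β' i))
    (fun s => uvForm_mem_formsOfDegree _ _ _ _ _) (uvForm_mem_formsOfDegree _ _ _ _ _)
    ((tα.mul (.const _)).add (tβ.mul (.const _))) (tβ.mul (.const _))
    (fun s => ?_) (fun s => ?_) (fun s => ?_) ?_
  · rw [val_uvForm_fst, low _ _ s hα', low _ _ s hβ', hP]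
  · rw [val_uvForm_snd, low _ _ s hβ', hQ]
  · rw [val_pderiv_one_uvForm_fst, val_pderiv_zero_uvForm_snd]
    linear_combination (((1 - s) * α 2 + s * α' 2) - ((1 - s) * β 1 + s * β' 1)) * hρξ
  · have d1 := eventually_ne_zero_of_differentiable
      (φ := fun s => lineDet (fun i => (1 - s) * α i + s * α' i)
        (fun i => (1 - s) * β i + s * β' i))
      (by simp only [lineDet]; fun_prop) (w := 1) (by simpa using h1)
    have d2 := eventually_ne_zero_of_differentiable
      (φ := fun s => lineDisc (fun i => (1 - s) * α i + s * α' i)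
        (fun i => (1 - s) * β i + s * β' i))
      (by simp only [lineDisc, lineDet]; fun_prop) (w := 1) (by simpa using h2)
    have d3 := eventually_ne_zero_of_differentiable
      (φ := fun s => lineCross (fun i => (1 - s) * α i + s * α' i)
        (fun i => (1 - s) * β i + s * β' i))
      (by simp only [lineCross]; fun_prop) (w := 1) (by simpa using h3)
    filter_upwards [d1, d2, d3] with s a1 a2 a3
    refine isGood_uvForm_of_generic a1 a2 a3 ?_ ?_
    · rw [low _ _ s hα', low _ _ s hβ', hP]
    · rw [low _ _ s hβ', hQ]

/-- A binary quadratic form `a U² + 2 b U V + c V²` is twice a product of linear forms. -/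
theorem exists_factorization (a b c : ℂ) : ∃ l₁ l₂ l₁' l₂' : ℂ,
    2 * (l₁ * l₁') = a ∧ l₁ * l₂' + l₂ * l₁' = b ∧ 2 * (l₂ * l₂') = c := by
  by_cases ha : a = 0
  -- the case `a = 0`, where `V` is a factor
  · exact ⟨0, 1, b, c / 2, by simp [ha], by ring, by ring⟩
  · obtain ⟨δ, hδ⟩ := IsAlgClosed.exists_pow_nat_eq (b ^ 2 - a * c) (n := 2) two_pos
    refine ⟨a, b + δ, 1 / 2, (b - δ) / (2 * a), by ring, by field_simp; ring, ?_⟩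
    field_simp
    linear_combination -hδ

/-- The critical point is an unramified point of `(U, V)`: the form is exact, and its Hamiltonian
splits into two conics through the critical point. -/
theorem isGood_uvForm_of_exact {ρ ξ ζ : ℂ} {α β : Fin 3 → ℂ} (hρξ : ρ * ξ ≠ 0)
    (hα : α 0 = 0) (hβ : β 0 = 0) (hαβ : β 1 = α 2) (hdet : lineDet α β ≠ 0) :
    IsGood (uvForm ρ ξ ζ α β) := by
  obtain ⟨l₁, l₂, l₁', l₂', e1, e2, e3⟩ := exists_factorization (α 1) (α 2) (β 2)
  have e := uvForm_eq_logForm ρ ξ ζ 1 1 (α := α) (β := β) (l := ![0, l₁, l₂])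
    (l' := ![0, l₁', l₂'])
    (fun i => by
      fin_cases i
      · simpa using hα
      · simp; linear_combination -e1
      · simp; linear_combination -e2)
    (fun i => by
      fin_cases i
      · simpa using hβ
      · simp; linear_combination hαβ - e2
      · simp; linear_combination -e3)
  rw [e]
  refine isGood_logForm_of_transversal rfl rfl fun h => hdet ?_
  simp only [uvQuad, Matrix.cons_val] at h
  have h' : l₁ * l₂' - l₂ * l₁' = 0 := by
    apply (mul_eq_zero.1 _).resolve_left hρξ
    linear_combination h
  rw [lineDet, hαβ, ← e1, ← e2, ← e3]
  linear_combination -(l₁ * l₂' - l₂ * l₁') * h'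

/-- A form with a linear pullback that is a Poincaré form has a critical point at the base point,
with symmetric and invertible linear part. -/
theorem critical_of_affinePullback_mem {η : Form} {A : Matrix (Fin 2) (Fin 2) ℂ} (hA : A.det ≠ 0)
    (h : affinePullback A 0 η ∈ poincareForms 3) :
    val η.1 = 0 ∧ val η.2 = 0 ∧ val (pderiv 1 η.1) = val (pderiv 0 η.2) ∧
      val (pderiv 0 η.1) * val (pderiv 1 η.2) - val (pderiv 1 η.1) * val (pderiv 0 η.2) ≠ 0 := by
  obtain ⟨-, h1, h2, h3, h4, h5, h6⟩ := h
  change val _ = 0 at h1 h2 h5 h6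
  change val _ = 1 at h3 h4
  have key : val (pderiv 0 (affinePullback A 0 η).1) * val (pderiv 1 (affinePullback A 0 η).2)
      - val (pderiv 1 (affinePullback A 0 η).1) * val (pderiv 0 (affinePullback A 0 η).2)
      = A.det ^ 2 * (val (pderiv 0 η.1) * val (pderiv 1 η.2)
        - val (pderiv 1 η.1) * val (pderiv 0 η.2)) := by
    simp only [affinePullback_eq, map_add, pderiv_C_mul, pderiv_zero_affineSubst,
      pderiv_one_affineSubst, map_mul, eval_C, val_affineSubst, Matrix.det_fin_two]
    ring
  rw [h3, h4, h5, h6] at key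
  simp only [affinePullback_eq, map_add, pderiv_C_mul, pderiv_zero_affineSubst,
      pderiv_one_affineSubst, map_mul, eval_C, val_affineSubst] at h1 h2 h5 h6
  rw [Matrix.det_fin_two] at hA
  refine ⟨?_, ?_, ?_, fun h0 => ?_⟩
  · apply (mul_eq_zero.1 _).resolve_left hA
    linear_combination A 1 1 * h1 - A 1 0 * h2
  · apply (mul_eq_zero.1 _).resolve_left hA
    linear_combination A 0 0 * h2 - A 0 1 * h1
  · rw [← sub_eq_zero]
    apply (mul_eq_zero.1 _).resolve_left hA
    linear_combination h5 - h6
  · rw [h0] at key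
    simp at key

theorem isGood_uvForm (ρ ξ ζ : ℂ) (α β : Fin 3 → ℂ) : IsGood (uvForm ρ ξ ζ α β) := by
  intro A hA hP
  obtain ⟨h1, h2, h3, h4⟩ := critical_of_affinePullback_mem hA hP
  rw [val_uvForm_fst] at h1
  rw [val_uvForm_snd] at h2
  rw [val_pderiv_one_uvForm_fst, val_pderiv_zero_uvForm_snd] at h3
  rw [val_pderiv_one_uvForm_fst, val_pderiv_zero_uvForm_snd, val_pderiv_zero_uvForm_fst,
    val_pderiv_one_uvForm_snd] at h4
  refine (?_ : IsGood (uvForm ρ ξ ζ α β)) A hA hP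
  by_cases hρξ : ρ * ξ = 0
  · refine isGood_uvForm_of_ramified hρξ ?_ h1 h2
    by_contra! hc
    apply h4
    rw [hc.1, hc.2]
    linear_combination ρ * ξ * (α 1 * β 2 - α 2 * β 1) * hρξ
  · have hρ := left_ne_zero_of_mul hρξ
    have hξ := right_ne_zero_of_mul hρξ
    have hβ : β 0 = 0 := (mul_eq_zero.1 h2).resolve_right hξ
    have hα : α 0 = 0 := by
      rw [hβ, zero_mul, add_zero] at h1
      exact (mul_eq_zero.1 h1).resolve_right hρ
    refine isGood_uvForm_of_exact hρξ hα hβ ?_ fun hd => h4 ?_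
    · rw [← sub_eq_zero]
      apply (mul_eq_zero.1 _).resolve_left hρξ
      linear_combination -h3
    · unfold lineDet at hd
      rw [hα, hβ]
      linear_combination ρ ^ 2 * ξ ^ 2 * hd

/-! ### The family `CR₅` -/

/-- Translated to an arbitrary point, a member of the family is the pullback of an affine-linear
form by `(U, V)`. -/
theorem affinePullback_one_cr5Form (c k l m n p q : ℂ) (b : Fin 2 → ℂ) :
    affinePullback 1 b (cr5Form c k l m n p q) = uvForm (2 * b 0 + c) (b 0) (b 1)
      ![-p - q * (b 0 ^ 2 + c * b 0) + (m - n - q) * (b 0 * b 1), -q, m - n - q]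
      ![-(l + p) - (m + q) * (b 0 ^ 2 + c * b 0) - (k + n + q) * (b 0 * b 1), -(m + q),
        -(k + n + q)] := by
  simp only [affinePullback_eq, cr5Form, uvForm, uvQuad, Quad.toPoly, map_add, map_sub, map_mul,
    map_neg, map_pow, map_ofNat, affineSubst_C, affineSubst_X, Matrix.cons_val, Matrix.one_apply_eq,
    Matrix.one_apply_ne zero_ne_one, Matrix.one_apply_ne one_ne_zero, C_0, C_1]
  ext1
  · ring
  · ring

theorem xCR5_subset_zariskiClosure : XCR5 ⊆ zariskiClosure (X_ 3 ![2, 2]) := by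
  rintro _ ⟨⟨c, k, l, m, n, p, q, A, b, hA, rfl⟩, hP⟩
  have h : affinePullback A b (cr5Form c k l m n p q)
      = affinePullback A 0 (affinePullback 1 b (cr5Form c k l m n p q)) := by
    rw [affinePullback_comp, one_mul]
  rw [h, affinePullback_one_cr5Form] at hP ⊢
  exact isGood_uvForm _ _ _ _ _ A hA.ne_zero hP

/-! ### The two conics of the general member -/

/-- The point `(a₂₀ : a₁₁ : a₀₀)` that belongs to a root `t` of `q t² - n t + k`. -/
def conicPoint (l m p q t : ℂ) : Fin 3 → ℂ := ![m - q * t, (m - q * t) * (1 + t), l - p * t]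

/-- The cofactor of a conic is a multiple of the polynomial `x (2 x + c z)`, which defines the
ramification of the map `(x² + c x, x y)`. -/
theorem isCofactor_conic {c k l m n p q t : ℂ} (ht : q * t ^ 2 - n * t + k = 0) :
    IsCofactor 3 (cr5Form c k l m n p q) (conic c (conicPoint l m p q t))
      (C (q * t - m) * (X 0 * (2 * X 0 + C c * X 2))) := by
  constructor
  · have hX := isHomogeneous_X (R := ℂ) (σ := Fin 3)
    exact isHomogeneous_C_mul _ ((hX 0).mul ((isHomogeneous_C_mul 2 (hX 0)).add
      (isHomogeneous_C_mul c (hX 2))))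
  · have hk : (C k : Poly) = C n * C t - C q * C t ^ 2 := by
      rw [← C_pow, ← C_mul, ← C_mul, ← C_sub]
      congr 1
      linear_combination ht
    simp [conic, conicPoint, cr5Form, pderiv_X]
    rw [hk]
    ring

theorem conic_isHomogeneous (c : ℂ) (a : Fin 3 → ℂ) : (conic c a).IsHomogeneous 2 := by
  have h : conic c a = (⟨a 0, a 1, 0, c * a 0, 0, a 2⟩ : Quad).toPoly := by
    simp [conic, Quad.toPoly]
  rw [h]
  exact Quad.isHomogeneous_toPoly _

theorem conic_ne_zero (c : ℂ) {a : Fin 3 → ℂ} (h : a 0 ≠ 0) : conic c a ≠ 0 := by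
  intro h0
  have h1 := congrArg (fun F => eval ![1, 0, 1] F) h0
  have h2 := congrArg (fun F => eval ![-1, 0, 1] F) h0
  have h3 := congrArg (fun F => eval ![0, 0, 1] F) h0
  simp [conic] at h1 h2 h3
  apply h
  linear_combination h1 / 2 + h2 / 2 - h3

theorem rank_lt_card_iff {m n K : Type*} [Field K] [Fintype m] [Fintype n] (M : Matrix m n K) :
    M.rank < Fintype.card n ↔ ∃ w : n → K, w ≠ 0 ∧ M.mulVec w = 0 := by
  have h := M.mulVecLin.finrank_range_add_finrank_ker
  rw [Module.finrank_pi] at h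
  rw [Matrix.rank, ← h, Nat.lt_add_right_iff_pos, Module.finrank_pos_iff_exists_ne_zero]
  constructor
  · rintro ⟨⟨w, hw⟩, hne⟩
    exact ⟨w, fun h => hne (Subtype.ext h), hw⟩
  · rintro ⟨w, hne, hw⟩
    exact ⟨⟨w, hw⟩, fun h => hne (congrArg Subtype.val h)⟩

/-- A kernel vector of the matrix, scaled to have first entry `1`, expresses `v` linearly in its two
other entries, whose ratio then satisfies a quadratic equation. -/
theorem rank_conicMatrix_le_two_iff {k l m n p q t t' : ℂ} (hdet : m ^ 2 - m * n + q * k ≠ 0)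
    (hroots : ∀ w : ℂ × ℂ, q * w.1 ^ 2 - n * w.1 * w.2 + k * w.2 ^ 2
      = q * (w.1 - t * w.2) * (w.1 - t' * w.2)) (hq : q ≠ 0) (v : Fin 3 → ℂ) :
    (conicMatrix k l m n p q v).rank ≤ 2 ↔
      (∃ r : ℂ, v = r • conicPoint l m p q t) ∨ (∃ r : ℂ, v = r • conicPoint l m p q t') := by
  have hker : (conicMatrix k l m n p q v).rank ≤ 2 ↔
      ∃ w : Fin 3 → ℂ, w ≠ 0 ∧ (conicMatrix k l m n p q v).mulVec w = 0 := by
    rw [← rank_lt_card_iff, Fintype.card_fin, Nat.lt_succ_iff]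
  have hmul : ∀ w : Fin 3 → ℂ, (conicMatrix k l m n p q v).mulVec w = 0 ↔
      v 0 * w 0 + q * w 1 + (-m - q) * w 2 = 0 ∧
      -v 1 * w 0 + (m - n - q) * w 1 + (k + n + q) * w 2 = 0 ∧
      v 2 * w 0 + p * w 1 + (-l - p) * w 2 = 0 ∧ -v 0 * w 1 + v 1 * w 2 = 0 := by
    intro w
    rw [funext_iff, Fin.forall_fin_succ, Fin.forall_fin_succ, Fin.forall_fin_two]
    simp [conicMatrix, Matrix.mulVec, dotProduct, Fin.sum_univ_three]
  have ht : q * t ^ 2 - n * t + k = 0 := by linear_combination hroots (t, 1)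
  have ht' : q * t' ^ 2 - n * t' + k = 0 := by linear_combination hroots (t', 1)
  have back : ∀ t, q * t ^ 2 - n * t + k = 0 → (∃ r : ℂ, v = r • conicPoint l m p q t) →
      ∃ w : Fin 3 → ℂ, w ≠ 0 ∧ (conicMatrix k l m n p q v).mulVec w = 0 := by
    rintro t ht ⟨r, rfl⟩
    refine ⟨![1, r * (1 + t), r], fun h => one_ne_zero (congrFun h 0), ?_⟩
    rw [hmul]
    simp only [conicPoint, Pi.smul_apply, smul_eq_mul, Matrix.cons_val]
    refine ⟨by ring, by linear_combination r * ht, by ring, by ring⟩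
  rw [hker]
  constructor
  · rintro ⟨w, hw, hMw⟩
    obtain ⟨h0, h1, h2, h3⟩ := (hmul w).1 hMw
    have w0 : w 0 ≠ 0 := by
      intro w0
      rw [w0] at h0 h1
      have w1 : w 1 = 0 := by
        apply (mul_eq_zero.1 _).resolve_left hdet
        linear_combination (k + n + q) * h0 + (m + q) * h1
      have w2 : w 2 = 0 := by
        apply (mul_eq_zero.1 _).resolve_left hdet
        linear_combination q * h1 - (m - n - q) * h0
      exact hw (by ext i; fin_cases i <;> simp [w0, w1, w2])
    have hquad : q * (w 1 - w 2) ^ 2 - n * (w 1 - w 2) * w 2 + k * w 2 ^ 2 = 0 := by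
      linear_combination w 1 * h0 + w 2 * h1 + w 0 * h3
    rw [hroots (w 1 - w 2, w 2)] at hquad
    have fin : ∀ t, q * t ^ 2 - n * t + k = 0 → w 1 - w 2 - t * w 2 = 0 →
        ∃ r : ℂ, v = r • conicPoint l m p q t := by
      intro t ht e
      refine ⟨w 2 / w 0, ?_⟩
      ext i
      fin_cases i
      · simp [conicPoint]
        field_simp
        linear_combination h0 - q * e
      · simp [conicPoint]
        field_simp
        linear_combination -h1 + (m - n - q) * e + w 2 * ht
      · simp [conicPoint]
        field_simp
        linear_combination h2 - p * e
    rcases mul_eq_zero.1 hquad with h | h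
    · exact .inl (fin t ht ((mul_eq_zero.1 h).resolve_left hq))
    · exact .inr (fin t' ht' h)
  · rintro (h | h)
    · exact back t ht h
    · exact back t' ht' h

theorem exists_two_conics : ∃ Δ : MvPolynomial (Fin 7) ℂ, Δ ≠ 0 ∧
      ∀ c k l m n p q : ℂ, MvPolynomial.eval ![c, k, l, m, n, p, q] Δ ≠ 0 →
        ∃ a b : Fin 3 → ℂ,
          LinearIndependent ℂ ![a, b] ∧
          (∀ v : Fin 3 → ℂ, (conicMatrix k l m n p q v).rank ≤ 2 ↔
            ((∃ r : ℂ, v = r • a) ∨ (∃ r : ℂ, v = r • b))) ∧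
          (a 0 ≠ 0 ∨ a 1 ≠ 0) ∧ (b 0 ≠ 0 ∨ b 1 ≠ 0) ∧
          IsIntegralCurve 3 (cr5Form c k l m n p q) 2 (conic c a) ∧
          IsIntegralCurve 3 (cr5Form c k l m n p q) 2 (conic c b) ∧
          IsDarbouxIntegrable 3 (cr5Form c k l m n p q) ![conic c a, conic c b] := by
  -- the factors are the leading coefficient `q` and the discriminant of `q t² - n t + k`, and the
  -- product of the two eigenvalues `m - q t`
  refine ⟨X 6 * (X 4 ^ 2 - 4 * X 6 * X 1) * (X 3 ^ 2 - X 3 * X 4 + X 6 * X 1), ?_, ?_⟩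
  · intro h
    have := congrArg (fun F => eval ![0, 0, 0, 2, 1, 0, 1] F) h
    norm_num [Matrix.cons_val] at this
    simp at this
    norm_num at this
  intro c k l m n p q hΔ
  have hΔ' : q * (n ^ 2 - 4 * q * k) * (m ^ 2 - m * n + q * k) ≠ 0 := by
    simpa [-mul_eq_zero] using hΔ
  have hdet := right_ne_zero_of_mul hΔ'
  have hdisc := right_ne_zero_of_mul (left_ne_zero_of_mul hΔ')
  have hq := left_ne_zero_of_mul (left_ne_zero_of_mul hΔ')
  obtain ⟨δ, hδ⟩ := IsAlgClosed.exists_pow_nat_eq (n ^ 2 - 4 * q * k) (n := 2) two_pos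
  have hδ0 : δ ≠ 0 := fun h => hdisc (by rw [← hδ, h]; ring)
  obtain ⟨t, t', hne, hsum, hprod⟩ : ∃ t t' : ℂ, t ≠ t' ∧ q * (t + t') = n ∧ q * (t * t') = k := by
    refine ⟨(n + δ) / (2 * q), (n - δ) / (2 * q), fun h => hδ0 ?_, ?_, ?_⟩
    · field_simp at h
      linear_combination h / 2
    · field_simp
      ring
    · field_simp
      linear_combination -hδ
  have hroots : ∀ w : ℂ × ℂ, q * w.1 ^ 2 - n * w.1 * w.2 + k * w.2 ^ 2
      = q * (w.1 - t * w.2) * (w.1 - t' * w.2) := by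
    intro w
    rw [← hsum, ← hprod]
    ring
  have ht : q * t ^ 2 - n * t + k = 0 := by linear_combination hroots (t, 1)
  have ht' : q * t' ^ 2 - n * t' + k = 0 := by linear_combination hroots (t', 1)
  have hprod0 : (m - q * t) * (m - q * t') ≠ 0 := by
    convert hdet using 1
    rw [← hsum, ← hprod]
    ring
  have h0 := left_ne_zero_of_mul hprod0
  have h0' := right_ne_zero_of_mul hprod0
  have hK := isCofactor_conic (c := c) (l := l) (m := m) (p := p) ht
  have hK' := isCofactor_conic (c := c) (l := l) (m := m) (p := p) ht'
  have hc : conic c (conicPoint l m p q t) ≠ 0 := conic_ne_zero c h0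
  have hc' : conic c (conicPoint l m p q t') ≠ 0 := conic_ne_zero c h0'
  refine ⟨conicPoint l m p q t, conicPoint l m p q t', ?_,
    rank_conicMatrix_le_two_iff hdet hroots hq, .inl h0, .inl h0',
    ⟨conic_isHomogeneous _ _, hc, _, hK⟩, ⟨conic_isHomogeneous _ _, hc', _, hK'⟩, ?_, ?_⟩
  · rw [LinearIndependent.pair_iff]
    intro r s hrs
    have e0 : r * (m - q * t) + s * (m - q * t') = 0 := by
      simpa [conicPoint] using congrFun hrs 0
    have e1 : r * ((m - q * t) * (1 + t)) + s * ((m - q * t') * (1 + t')) = 0 := by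
      simpa [conicPoint] using congrFun hrs 1
    constructor
    · apply (mul_eq_zero.1 _).resolve_right (mul_ne_zero h0 (sub_ne_zero.2 hne))
      linear_combination e1 - (1 + t') * e0
    · apply (mul_eq_zero.1 _).resolve_right (mul_ne_zero h0' (sub_ne_zero.2 hne.symm))
      linear_combination e1 - (1 + t) * e0
  · intro i
    fin_cases i
    · exact ⟨hc, 2, conic_isHomogeneous _ _⟩
    · exact ⟨hc', 2, conic_isHomogeneous _ _⟩
  · refine ⟨![C (q * t - m) * (X 0 * (2 * X 0 + C c * X 2)),
      C (q * t' - m) * (X 0 * (2 * X 0 + C c * X 2))], ![1, 1], fun i => ?_, ?_⟩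
    · fin_cases i
      · exact hK
      · exact hK'
    · have hn : (C n : Poly) = C q * (C t + C t') := by rw [← C_add, ← C_mul, hsum]
      simp [cr5Form, pderiv_X, pderiv_const_two, hn]
      ring

end CubicCenter

theorem mainTheorem10 :
    -- the general member: parameters outside the zero set of a nonzero polynomial
    (∃ Δ : MvPolynomial (Fin 7) ℂ, Δ ≠ 0 ∧
      ∀ c k l m n p q : ℂ, MvPolynomial.eval ![c, k, l, m, n, p, q] Δ ≠ 0 →
        ∃ a b : Fin 3 → ℂ,
          -- the rank condition singles out exactly two points of the projective plane
          LinearIndependent ℂ ![a, b] ∧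
          (∀ v : Fin 3 → ℂ, (CubicCenter.conicMatrix k l m n p q v).rank ≤ 2 ↔
            ((∃ r : ℂ, v = r • a) ∨ (∃ r : ℂ, v = r • b))) ∧
          -- their equations have degree two in the affine coordinates
          (a 0 ≠ 0 ∨ a 1 ≠ 0) ∧ (b 0 ≠ 0 ∨ b 1 ≠ 0) ∧
          CubicCenter.IsIntegralCurve 3 (CubicCenter.cr5Form c k l m n p q) 2
            (CubicCenter.conic c a) ∧
          CubicCenter.IsIntegralCurve 3 (CubicCenter.cr5Form c k l m n p q) 2
            (CubicCenter.conic c b) ∧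
          CubicCenter.IsDarbouxIntegrable 3 (CubicCenter.cr5Form c k l m n p q)
            ![CubicCenter.conic c a, CubicCenter.conic c b]) ∧
    CubicCenter.XCR5 ⊆ CubicCenter.zariskiClosure (CubicCenter.X_ 3 ![2, 2]) :=
  ⟨CubicCenter.exists_two_conics, CubicCenter.xCR5_subset_zariskiClosure⟩
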